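/- Let $n \ge 1$ and let $t_1,\dots,t_n \ge 1$ be integers. Consider the following game for two players who move alternately (planar generalized Brussels sprouts, $BS_n(\mathcal O_0 : t_1,\dots,t_n)$). It starts with $n$ spots (vertices) drawn in the plane, the $i$-th of which has $t_i$ open tips (short straight arms sticking out of the spot, each with one free end), and nothing crosses or overlaps. A move consists of joining the free ends of two different open tips by a polygonal curve that meets neither itself nor anything else already drawn, and then drawing across this curve, at a point of it that becomes a new vertex, a straight crossbar whose two halves, one on each side of the curve, are new open tips; the two joined tips are no longer open, and the resulting picture must again be without crossings. A player who has no valid move on his turn loses. Then, from every starting position and however the game is played, the game ends after exactly $$(n-2)+\sum_{i=1}^n t_i$$ moves: no play is longer, and a position reached after $k$ moves admits no further move if and only if $k=(n-2)+\sum_{i=1}^n t_i$. Hence every completed play is won by the first player if and only if $n+\sum_{i=1}^n t_i$ is odd, and the first player has a winning strategy if and only if $n+\sum_{i=1}^n t_i$ is odd. -/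

import Mathlib

namespace BrusselsSprout

/-- The plane; only its affine structure and its topology matter. -/
abbrev Plane : Type := ℝ × ℝ

/-- The set of points of the polygonal curve with the given successive corner points. -/
def carrier : List Plane → Set Plane
  | [] => ∅
  | [p] => {p}
  | p :: q :: l => segment ℝ p q ∪ carrier (q :: l)

/-- The polygonal curve through the given corner points is non-degenerate and does not meet
itself: each of its segments meets the rest of the curve after it only in their common corner. -/
def IsSimple : List Plane → Prop
  | [] => True
  | [_] => True
  | p :: q :: l => p ≠ q ∧ segment ℝ p q ∩ carrier (q :: l) = {q} ∧ IsSimple (q :: l)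

/-- A polygonal arc: a simple polygonal curve with at least one segment. -/
def IsArc (l : List Plane) : Prop :=
  2 ≤ l.length ∧ IsSimple l

/-- An open tip: a short arm, drawn as a straight segment from a vertex (its `root`)
to a `free` end. -/
@[ext]
structure Tip where
  root : Plane
  free : Plane

/-- The segment by which an open tip is drawn. -/
def Tip.stub (s : Tip) : List Plane := [s.root, s.free]

/-- A picture on the paper: the vertices (the spots, and the points where a crossbar meets a
curve), the edges (polygonal curves joining two vertices), and the arms that are still open. -/
@[ext]
structure Drawing where
  vertices : List Plane
  edges : List (List Plane)
  tips : List Tip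

/-- All the curves of a drawing: its edges and its open arms. -/
def Drawing.curves (D : Drawing) : List (List Plane) :=
  D.edges ++ D.tips.map Tip.stub

/-- The drawing is without crossings. Together with the fact that a curve contains no vertices
except its own end vertices, the last clause says that two different curves of the drawing meet
at most in common end vertices. -/
structure Drawing.IsPlane (D : Drawing) : Prop where
  /-- Different vertices are different points. -/
  nodup : D.vertices.Nodup
  /-- No curve meets itself. -/
  isArc : ∀ A ∈ D.curves, IsArc A
  /-- Every edge joins two vertices and contains no other vertex. -/
  edge_ends : ∀ A ∈ D.edges, ∃ u ∈ D.vertices, ∃ w ∈ D.vertices,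
    A.head? = some u ∧ A.getLast? = some w ∧
      ∀ v ∈ D.vertices, v ∈ carrier A → v = u ∨ v = w
  /-- Every open arm starts at a vertex and contains no other vertex. -/
  tip_ends : ∀ s ∈ D.tips, s.root ∈ D.vertices ∧
    ∀ v ∈ D.vertices, v ∈ carrier s.stub → v = s.root
  /-- Two different curves meet only in vertices. -/
  noncrossing : D.curves.Pairwise fun A B => ∀ x ∈ carrier A ∩ carrier B, x ∈ D.vertices

/-- The starting positions of the game: `n` spots in the plane and nothing else, where the
`i`-th spot has `t i` open tips. -/
def Drawing.IsInitial {n : ℕ} (t : Fin n → ℕ) (D : Drawing) : Prop :=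
  ∃ (v : Fin n → Plane) (a : (i : Fin n) → Fin (t i) → Plane),
    D.vertices = List.ofFn v ∧
    D.edges = [] ∧
    D.tips = (List.ofFn fun i => List.ofFn fun j => Tip.mk (v i) (a i j)).flatten ∧
    D.IsPlane

/-- A valid move from `D` to `D'`. Two open tips `s` and `t` of `D` are joined by a polygonal curve
`l₁, p, q, l₂` from the free end of `s` to the free end of `t`. Then a crossbar, the segment from
`c` to `d`, is drawn across this curve at a point `m` inside the segment from `p` to `q`. The point
`m` becomes a vertex that cuts the joined curve (with the arms `s` and `t`) into two edges; the two
halves of the crossbar, one on each side of the curve, are new open tips. The old picture stays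
as it is, and the new picture must again be without crossings (so the graph that it draws
is planar). -/
def IsMove (D D' : Drawing) : Prop :=
  ∃ (s t : Tip) (rest : List Tip) (l₁ l₂ : List Plane) (p q m c d : Plane),
    D.tips.Perm (s :: t :: rest) ∧
    (l₁ ++ p :: q :: l₂).head? = some s.free ∧
    (l₁ ++ p :: q :: l₂).getLast? = some t.free ∧
    m ∈ openSegment ℝ p q ∧
    m ∈ openSegment ℝ c d ∧
    D'.vertices = m :: D.vertices ∧
    D'.edges = (s.root :: (l₁ ++ [p, m])) :: (m :: q :: (l₂ ++ [t.root])) :: D.edges ∧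
    D'.tips = Tip.mk m c :: Tip.mk m d :: rest ∧
    D'.IsPlane

/-- No valid move is left. -/
def IsOver (D : Drawing) : Prop := ∀ D' : Drawing, ¬ IsMove D D'

/-- `IsPlay D k D'`: there is a play that leads from `D` to `D'` in exactly `k` valid moves. -/
inductive IsPlay (D : Drawing) : ℕ → Drawing → Prop
  | start : IsPlay D 0 D
  | step {k : ℕ} {D' D'' : Drawing} : IsPlay D k D' → IsMove D' D'' → IsPlay D (k + 1) D''

/-- The game from `D` always ends after exactly `N` moves, however it is played: no play has more
than `N` moves, and a play is stuck precisely when `N` moves have been made. -/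
def EndsAfterExactly (D : Drawing) (N : ℕ) : Prop :=
  ∀ (k : ℕ) (D' : Drawing), IsPlay D k D' → k ≤ N ∧ (IsOver D' ↔ k = N)

/-- The two players. -/
inductive Player
  | first
  | second

/-- The opponent of a player. -/
def Player.other : Player → Player
  | .first => .second
  | .second => .first

/-- The player whose turn it is after `k` moves: the players alternate, and the first player
makes the first move. -/
def turn : ℕ → Player
  | 0 => .first
  | k + 1 => (turn k).other

/-- The winner of a play that is over after `k` moves: the player whose turn it is has no valid
move and loses, so the other player wins. -/
def winnerAfter (k : ℕ) : Player := (turn k).other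

/-- The player who is to move in `D` can force a win: some valid move leads to a position
from which, whatever valid move the opponent replies with (if there is any), the player
can again force a win. -/
inductive CanForceWin : Drawing → Prop
  | intro (D D' : Drawing) : IsMove D D' →
      (∀ D'' : Drawing, IsMove D' D'' → CanForceWin D'') → CanForceWin D

end BrusselsSprout

/-!
A move adds one vertex and two edges to the graph and keeps the number of open tips. If the tips
that it joins belong to different components, it merges these. Otherwise the drawn curve closes up
with the graph, the two halves of the crossbar lie on different sides of it, and a face is divided
into two faces that both contain tips. So the number of faces with tips minus the number of
components grows with every move; since there are at most as many such faces as tips, this bounds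
the number of moves from above.

As long as two open tips lie in the same face, they can be joined by a polygonal arc, and there is
a move. In a final position, the tips lie in different faces. Moreover, from every point near a
component of the graph one can walk along the component to one of its tips, a property that moves
preserve: the new crossbar serves both sides of the new curve. A shortest segment between two
components would therefore connect tips of both inside one face. So the graph is connected, and
the inequality in Euler's formula that needs no separation theorem, `F ≤ E - V + 2`, bounds the
number of tips, hence the number of moves from below.

That the two halves of the crossbar are separated is the only part of the Jordan curve theorem in
use. For a closed polygon, the sum of the angles under which its edges are seen from a point is a
multiple of `2π`. It is constant along paths outside the polygon, and jumps across an edge.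
-/

namespace BrusselsSprout

open Filter Set Topology

/-- `a` and `b` are joined by a polygonal path inside `S`. The faces of a closed set `X` are the
classes of `PolyJoined Xᶜ`; constant paths count even outside `S`, which makes this an equivalence
relation on the whole space. -/
def PolyJoined {E : Type*} [AddCommGroup E] [Module ℝ E] (S : Set E) : E → E → Prop :=
  Relation.ReflTransGen fun a b => segment ℝ a b ⊆ S

namespace PolyJoined

section Module

variable {E : Type*} [AddCommGroup E] [Module ℝ E] {S T : Set E} {a b c : E}

theorem refl (a : E) : PolyJoined S a a := Relation.ReflTransGen.refl

theorem trans (h : PolyJoined S a b) (h' : PolyJoined S b c) : PolyJoined S a c :=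
  Relation.ReflTransGen.trans h h'

theorem symm (h : PolyJoined S a b) : PolyJoined S b a := by
  induction h with
  | refl => exact refl _
  | tail _ h ih => exact Relation.ReflTransGen.head (by rwa [segment_symm]) ih

theorem mono (hST : S ⊆ T) (h : PolyJoined S a b) : PolyJoined T a b := by
  induction h with
  | refl => exact refl _
  | tail _ h ih => exact Relation.ReflTransGen.tail ih (h.trans hST)

theorem of_segment (h : segment ℝ a b ⊆ S) : PolyJoined S a b := Relation.ReflTransGen.single h

theorem of_convex {C : Set E} (hC : Convex ℝ C) (hCS : C ⊆ S) (ha : a ∈ C) (hb : b ∈ C) :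
    PolyJoined S a b := of_segment ((hC.segment_subset ha hb).trans hCS)

theorem mem (h : PolyJoined S a b) (ha : a ∈ S) : b ∈ S := by
  induction h with
  | refl => exact ha
  | tail _ h _ => exact h (right_mem_segment ℝ _ _)

theorem diff_or_exists_mem (T : Set E) (h : PolyJoined S a b) :
    PolyJoined (S \ T) a b ∨ ∃ g ∈ T, g ∈ S ∧ PolyJoined S a g := by
  induction h with
  | refl => exact .inl (refl _)
  | @tail x y hax hxy ih =>
    refine ih.elim (fun hax' => ?_) .inr
    by_cases hT : Disjoint (segment ℝ x y) T
    · exact .inl (hax'.trans (of_segment fun z hz => ⟨hxy hz, disjoint_left.1 hT hz⟩))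
    · obtain ⟨g, hg, hgT⟩ := not_disjoint_iff.1 hT
      exact .inr ⟨g, hgT, hxy hg, PolyJoined.trans hax
        (.of_convex (convex_segment x y) hxy (left_mem_segment ℝ x y) hg)⟩

end Module

section TopologicalSpace

variable {E : Type*} [AddCommGroup E] [Module ℝ E] [TopologicalSpace E] [IsTopologicalAddGroup E]
  [ContinuousSMul ℝ E] {S : Set E} {a b : E}

theorem mem_of_subset_union {U V : Set E} (h : PolyJoined S a b) (hU : IsOpen U) (hV : IsOpen V)
    (hUV : Disjoint U V) (hS : S ⊆ U ∪ V) (ha : a ∈ U) : b ∈ U := by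
  induction h with
  | refl => exact ha
  | tail _ h ih =>
    exact (convex_segment _ _).isPreconnected.subset_left_of_subset_union hU hV hUV
      (h.trans hS) ⟨_, left_mem_segment ℝ _ _, ih⟩ (right_mem_segment ℝ _ _)

theorem eq_of_mapsTo_discrete {Y : Type*} [TopologicalSpace Y] {f : E → Y} {T : Set Y}
    (h : PolyJoined S a b) (hf : ContinuousOn f S) (hT : IsDiscrete T) (hfT : MapsTo f S T) :
    f a = f b := by
  induction h with
  | refl => rfl
  | tail _ h ih =>
    exact ih.trans ((convex_segment _ _).isPreconnected.constant_of_mapsTo hT (hf.mono h)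
      (hfT.mono_left h) (left_mem_segment ℝ _ _) (right_mem_segment ℝ _ _))

end TopologicalSpace

end PolyJoined

/-- `W` is a union of classes of `PolyJoined S` inside `S`; for `S = Xᶜ` this is a union of
faces of `X`. -/
def PolySaturated {E : Type*} [AddCommGroup E] [Module ℝ E] (S W : Set E) : Prop :=
  W ⊆ S ∧ ∀ ⦃z w⦄, z ∈ W → PolyJoined S z w → w ∈ W

namespace PolySaturated

section Module

variable {E : Type*} [AddCommGroup E] [Module ℝ E] {S W W' : Set E}

theorem diff (hW : PolySaturated S W) : PolySaturated S (S \ W) :=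
  ⟨sdiff_subset, fun _ _ hz h => ⟨h.mem hz.1, fun hw => hz.2 (hW.2 hw h.symm)⟩⟩

theorem union (hW : PolySaturated S W) (hW' : PolySaturated S W') : PolySaturated S (W ∪ W') :=
  ⟨union_subset hW.1 hW'.1, fun _ _ hz h => hz.imp (hW.2 · h) (hW'.2 · h)⟩

theorem setOf_polyJoined (S : Set E) (a : E) : PolySaturated S {z ∈ S | PolyJoined S z a} :=
  ⟨sep_subset _ _, fun _ _ hz h => ⟨h.mem hz.1, h.symm.trans hz.2⟩⟩

end Module

variable {E : Type*} [AddCommGroup E] [Module ℝ E] [TopologicalSpace E] [LocallyConvexSpace ℝ E]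
  {S W : Set E}

theorem isOpen (hW : PolySaturated S W) (hS : IsOpen S) : IsOpen W := by
  rw [isOpen_iff_mem_nhds]
  intro z hz
  obtain ⟨C, ⟨hC, hCconv⟩, hCS⟩ :=
    (LocallyConvexSpace.convex_basis (𝕜 := ℝ) z).mem_iff.1 (hS.mem_nhds (hW.1 hz))
  exact mem_of_superset hC fun w hw => hW.2 hz (.of_convex hCconv hCS (mem_of_mem_nhds hC) hw)

end PolySaturated

theorem PolyJoined.of_isPreconnected {E : Type*} [AddCommGroup E] [Module ℝ E]
    [TopologicalSpace E] [LocallyConvexSpace ℝ E] {S : Set E} (hc : IsPreconnected S)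
    (hS : IsOpen S) {a b : E} (ha : a ∈ S) (hb : b ∈ S) : PolyJoined S a b := by
  have hW := PolySaturated.setOf_polyJoined S b
  by_contra hab
  obtain ⟨z, -, hz, hz'⟩ := hc _ _ (hW.isOpen hS) (hW.diff.isOpen hS)
    (fun z hz => (em (z ∈ {z ∈ S | PolyJoined S z b})).imp id fun h => ⟨hz, h⟩)
    ⟨b, hb, hb, .refl b⟩ ⟨a, ha, ha, fun h => hab h.2⟩
  exact hz'.2 hz

theorem eventually_add_smul_mem {E : Type*} [AddCommGroup E] [Module ℝ E] [TopologicalSpace E]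
    [ContinuousAdd E] [ContinuousSMul ℝ E] {U : Set E} {y : E} (hU : U ∈ 𝓝 y) (v : E) :
    ∀ᶠ t : ℝ in 𝓝 0, y + t • v ∈ U := by
  have hc : ContinuousAt (fun t : ℝ => y + t • v) 0 := by fun_prop
  exact hc (by simpa using hU)

theorem isCompact_segment {E : Type*} [AddCommGroup E] [Module ℝ E] [TopologicalSpace E]
    [ContinuousAdd E] [ContinuousSMul ℝ E] (p q : E) : IsCompact (segment ℝ p q) := by
  rw [segment_eq_image]
  exact isCompact_Icc.image (by fun_prop)

theorem isClosed_segment (p q : Plane) : IsClosed (segment ℝ p q) :=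
  (isCompact_segment p q).isClosed

/-- Twice the signed area of the triangle `p q z`, as an affine function of `z`: its sign tells the
two sides of the line through `p` and `q` apart. -/
def side (p q : Plane) : Plane →ᵃ[ℝ] ℝ where
  toFun z := (q.1 - p.1) * (z.2 - p.2) - (q.2 - p.2) * (z.1 - p.1)
  linear := (q.1 - p.1) • LinearMap.snd ℝ ℝ ℝ - (q.2 - p.2) • LinearMap.fst ℝ ℝ ℝ
  map_vadd' z v := by
    simp only [vadd_eq_add, Prod.snd_add, Prod.fst_add, LinearMap.sub_apply, LinearMap.smul_apply,
      LinearMap.snd_apply, smul_eq_mul, LinearMap.fst_apply]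
    ring

section Side

variable {p q m y z a c v : Plane} {t : ℝ} {C U X : Set Plane}

theorem side_apply (p q z : Plane) :
    side p q z = (q.1 - p.1) * (z.2 - p.2) - (q.2 - p.2) * (z.1 - p.1) := rfl

theorem side_swap (p q z : Plane) : side q p z = -side p q z := by simp only [side_apply]; ring

theorem side_eq_zero_of_mem_segment (h : z ∈ segment ℝ p q) : side p q z = 0 := by
  rw [segment_eq_image'] at h
  obtain ⟨t, -, rfl⟩ := h
  simp only [side_apply, Prod.fst_add, Prod.snd_add, Prod.smul_fst, Prod.smul_snd, Prod.fst_sub,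
    Prod.snd_sub, smul_eq_mul]
  ring

theorem side_add_smul (h : side p q y = 0) (v : Plane) (t : ℝ) :
    side p q (y + t • v) = t * (side p q).linear v := by
  rw [add_comm, ← vadd_eq_add, AffineMap.map_vadd, h, map_smul, vadd_eq_add, add_zero, smul_eq_mul]

theorem side_sub_smul (h : side p q y = 0) (v : Plane) (t : ℝ) :
    side p q (y - t • v) = -(t * (side p q).linear v) := by
  rw [sub_eq_add_neg, ← neg_smul, side_add_smul h, neg_mul]

theorem exists_side_linear_pos (h : p ≠ q) : ∃ v, 0 < (side p q).linear v := by
  refine ⟨(p.2 - q.2, q.1 - p.1), ?_⟩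
  have hsq : (side p q).linear (p.2 - q.2, q.1 - p.1) = (q.1 - p.1) ^ 2 + (q.2 - p.2) ^ 2 := by
    simp only [side, LinearMap.sub_apply, LinearMap.smul_apply, LinearMap.snd_apply,
      LinearMap.fst_apply, smul_eq_mul]
    ring
  rw [hsq]
  by_contra! hle
  refine h (Prod.ext ?_ ?_) <;> nlinarith [sq_nonneg (q.1 - p.1), sq_nonneg (q.2 - p.2)]

theorem exists_side_pos (h : p ≠ q) (hy : side p q y = 0) (hU : U ∈ 𝓝 y) :
    ∃ z ∈ U, 0 < side p q z := by
  obtain ⟨v, hv⟩ := exists_side_linear_pos h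
  obtain ⟨t, ht, ht0⟩ := ((eventually_add_smul_mem hU v).filter_mono nhdsWithin_le_nhds).and
    (self_mem_nhdsWithin (a := (0 : ℝ)) (s := Ioi 0)) |>.exists
  exact ⟨_, ht, by rw [side_add_smul hy]; exact mul_pos ht0 hv⟩

theorem exists_side_neg (h : p ≠ q) (hy : side p q y = 0) (hU : U ∈ 𝓝 y) :
    ∃ z ∈ U, side p q z < 0 := by
  obtain ⟨z, hz, hs⟩ := exists_side_pos h.symm (by rw [side_swap, hy, neg_zero]) hU
  exact ⟨z, hz, by rwa [side_swap, neg_pos] at hs⟩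

theorem notMem_union_segment_of_side_ne_zero (hCX : C ⊆ Xᶜ) (hz : z ∈ C) (h : side p q z ≠ 0) :
    z ∈ (X ∪ segment ℝ p q)ᶜ :=
  fun hz' => hz'.elim (hCX hz) (h ∘ side_eq_zero_of_mem_segment)

theorem polyJoined_of_side_pos (hC : Convex ℝ C) (hCX : C ⊆ Xᶜ) (hz : z ∈ C)
    (hzs : z ∉ segment ℝ p q) (hz0 : 0 ≤ side p q z) (ha : a ∈ C) (ha0 : 0 < side p q a) :
    PolyJoined (X ∪ segment ℝ p q)ᶜ z a := by
  refine .of_segment fun x hx => ?_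
  have hxC := hC.segment_subset hz ha hx
  rw [← insert_endpoints_openSegment] at hx
  rcases hx with rfl | rfl | ⟨s, t, hs, ht, hst, rfl⟩
  · exact fun h => h.elim (hCX hz) hzs
  · exact notMem_union_segment_of_side_ne_zero hCX ha ha0.ne'
  · refine notMem_union_segment_of_side_ne_zero hCX hxC (ne_of_gt ?_)
    rw [Convex.combo_affine_apply hst]
    exact add_pos_of_nonneg_of_pos (mul_nonneg hs.le hz0) (mul_pos ht ha0)

theorem polyJoined_of_side_neg (hC : Convex ℝ C) (hCX : C ⊆ Xᶜ) (hz : z ∈ C)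
    (hzs : z ∉ segment ℝ p q) (hz0 : side p q z ≤ 0) (ha : a ∈ C) (ha0 : side p q a < 0) :
    PolyJoined (X ∪ segment ℝ p q)ᶜ z a := by
  rw [segment_symm] at hzs ⊢
  exact polyJoined_of_side_pos hC hCX hz hzs (by rwa [side_swap, neg_nonneg]) ha
    (by rwa [side_swap, neg_pos])

theorem polyJoined_or_of_side (hC : Convex ℝ C) (hCX : C ⊆ Xᶜ) (hz : z ∈ C)
    (hzs : z ∉ segment ℝ p q) (ha : a ∈ C) (ha0 : 0 < side p q a) (hc : c ∈ C)
    (hc0 : side p q c < 0) :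
    PolyJoined (X ∪ segment ℝ p q)ᶜ z a ∨ PolyJoined (X ∪ segment ℝ p q)ᶜ z c :=
  (le_total 0 (side p q z)).imp (polyJoined_of_side_pos hC hCX hz hzs · ha ha0)
    (polyJoined_of_side_neg hC hCX hz hzs · hc hc0)

theorem exists_mem_notMem_segment_side_eq_zero (h : p ≠ q) (hU : U ∈ 𝓝 p) :
    ∃ z ∈ U, z ∉ segment ℝ p q ∧ side p q z = 0 := by
  obtain ⟨t, ht, ht0⟩ := ((eventually_add_smul_mem hU (q - p)).filter_mono nhdsWithin_le_nhds).and
    (self_mem_nhdsWithin (a := (0 : ℝ)) (s := Iio 0)) |>.exists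
  refine ⟨_, ht, fun hmem => ?_, ?_⟩
  · rw [segment_eq_image'] at hmem
    obtain ⟨s, hs, hst⟩ := hmem
    have : s = t := smul_left_injective ℝ (sub_ne_zero.2 h.symm) (add_left_cancel hst)
    exact absurd hs.1 (this ▸ not_le.2 ht0)
  · rw [side_add_smul (side_eq_zero_of_mem_segment (left_mem_segment ℝ p q))]
    simp only [side, LinearMap.sub_apply, LinearMap.smul_apply, LinearMap.snd_apply,
      LinearMap.fst_apply, Prod.fst_sub, Prod.snd_sub, smul_eq_mul]
    ring

-- One can walk around the free end `p`, through a point on the prolongation of the segment.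
theorem polyJoined_around_left (h : p ≠ q) (hC : Convex ℝ C) (hCX : C ⊆ Xᶜ) (hCp : C ∈ 𝓝 p)
    (hz : z ∈ C) (hzs : z ∉ segment ℝ p q) (ha : a ∈ C) (has : a ∉ segment ℝ p q) :
    PolyJoined (X ∪ segment ℝ p q)ᶜ z a := by
  have hp0 := side_eq_zero_of_mem_segment (left_mem_segment ℝ p q)
  obtain ⟨b, hb, hbs, hb0⟩ := exists_mem_notMem_segment_side_eq_zero h hCp
  obtain ⟨u, hu, hu0⟩ := exists_side_pos h hp0 hCp
  obtain ⟨d, hd, hd0⟩ := exists_side_neg h hp0 hCp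
  have to_b : ∀ x ∈ C, x ∉ segment ℝ p q → PolyJoined (X ∪ segment ℝ p q)ᶜ x b := by
    intro x hx hxs
    rcases polyJoined_or_of_side hC hCX hx hxs hu hu0 hd hd0 with hxu | hxd
    · exact hxu.trans (polyJoined_of_side_pos hC hCX hb hbs hb0.ge hu hu0).symm
    · exact hxd.trans (polyJoined_of_side_neg hC hCX hb hbs hb0.le hd hd0).symm
  exact (to_b z hz hzs).trans (to_b a ha has).symm

end Side

section Spread

variable {X W : Set Plane} {p q m y y' z w : Plane}

theorem PolySaturated.subset_of_union_segment_mem_nhds {C : Set Plane}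
    (hW : PolySaturated (X ∪ segment ℝ p q)ᶜ W) (hpq : p ≠ q) (hC : Convex ℝ C) (hCX : C ⊆ Xᶜ)
    (hCy : C ∈ 𝓝 y) (hy : y ∈ segment ℝ p q) (hg : W ∪ segment ℝ p q ∈ 𝓝 y) :
    C ⊆ W ∪ segment ℝ p q := by
  intro z hz
  refine or_iff_not_imp_right.2 fun hzs => ?_
  have hy0 := side_eq_zero_of_mem_segment hy
  obtain ⟨a, ⟨haW, haC⟩, ha0⟩ := exists_side_pos hpq hy0 (inter_mem hg hCy)
  obtain ⟨c, ⟨hcW, hcC⟩, hc0⟩ := exists_side_neg hpq hy0 (inter_mem hg hCy)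
  replace haW := haW.resolve_right (ha0.ne' ∘ side_eq_zero_of_mem_segment)
  replace hcW := hcW.resolve_right (hc0.ne ∘ side_eq_zero_of_mem_segment)
  exact (polyJoined_or_of_side hC hCX hz hzs haC ha0 hcC hc0).elim
    (fun h => hW.2 haW h.symm) fun h => hW.2 hcW h.symm

theorem isPreconnected_segment_diff (hd : Disjoint (openSegment ℝ p q) X) :
    IsPreconnected (segment ℝ p q \ X) :=
  (convex_openSegment p q).isPreconnected.subset_closure
    (fun _ hx => ⟨openSegment_subset_segment ℝ p q hx, disjoint_left.1 hd hx⟩)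
    (fun _ hx => by rw [closure_openSegment]; exact hx.1)

theorem PolySaturated.union_segment_mem_nhds (hX : IsClosed X)
    (hW : PolySaturated (X ∪ segment ℝ p q)ᶜ W) (hpq : p ≠ q)
    (hd : Disjoint (openSegment ℝ p q) X) (hy : y ∈ segment ℝ p q \ X)
    (hg : W ∪ segment ℝ p q ∈ 𝓝 y) (hy' : y' ∈ segment ℝ p q \ X) :
    W ∪ segment ℝ p q ∈ 𝓝 y' := by
  refine (isPreconnected_segment_diff hd).induction₂'
    (fun x x' => W ∪ segment ℝ p q ∈ 𝓝 x → W ∪ segment ℝ p q ∈ 𝓝 x') (fun x hx => ?_)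
    (fun _ _ _ _ _ _ h h' => h' ∘ h) hy hy' hg
  obtain ⟨r, hr, hball⟩ := Metric.isOpen_iff.1 hX.isOpen_compl x hx.2
  have spread : ∀ u ∈ Metric.ball x r, u ∈ segment ℝ p q → W ∪ segment ℝ p q ∈ 𝓝 u →
      ∀ u' ∈ Metric.ball x r, W ∪ segment ℝ p q ∈ 𝓝 u' := fun u hu hus hug u' hu' =>
    mem_of_superset (Metric.isOpen_ball.mem_nhds hu')
      (hW.subset_of_union_segment_mem_nhds hpq (convex_ball x r) hball
        (Metric.isOpen_ball.mem_nhds hu) hus hug)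
  filter_upwards [self_mem_nhdsWithin, mem_nhdsWithin_of_mem_nhds (Metric.ball_mem_nhds x hr)]
    with u hu hur
  exact ⟨fun h => spread x (Metric.mem_ball_self hr) hx.1 h u hur,
    fun h => spread u hur hu.1 h x (Metric.mem_ball_self hr)⟩

theorem PolySaturated.mem_of_polyJoined_segment (hX : IsClosed X)
    (hW : PolySaturated (X ∪ segment ℝ p q)ᶜ W) (hpq : p ≠ q)
    (hd : Disjoint (openSegment ℝ p q) X) (hy : y ∈ segment ℝ p q \ X)
    (hg : W ∪ segment ℝ p q ∈ 𝓝 y) (hz : z ∉ X ∪ segment ℝ p q)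
    (hy' : y' ∈ segment ℝ p q \ X) (hzy : PolyJoined Xᶜ z y') : z ∈ W := by
  have hYo : IsOpen (X ∪ segment ℝ p q)ᶜ := (hX.union (isClosed_segment p q)).isOpen_compl
  have near : ∀ x ∈ segment ℝ p q \ X, x ∈ interior (W ∪ segment ℝ p q) := fun x hx =>
    mem_interior_iff_mem_nhds.2 (hW.union_segment_mem_nhds hX hpq hd hy hg hx)
  have hzW : z ∈ interior (W ∪ segment ℝ p q) :=
    hzy.symm.mem_of_subset_union isOpen_interior (hW.diff.isOpen hYo)
      (disjoint_left.2 fun x hx hx' =>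
        (interior_subset hx).elim hx'.2 fun h => hx'.1 (.inr h)) (fun x hx => ?_) (near y' hy')
  · exact (interior_subset hzW).resolve_right fun h => hz (.inr h)
  by_cases hxs : x ∈ segment ℝ p q
  · exact .inl (near x ⟨hxs, hx⟩)
  by_cases hxW : x ∈ W
  · exact .inl (interior_mono subset_union_left ((hW.isOpen hYo).interior_eq.symm ▸ hxW))
  · exact .inr ⟨fun h => h.elim hx hxs, hxW⟩

theorem PolyJoined.union_segment_of_free (hX : IsClosed X) (hpq : p ≠ q)
    (hd : segment ℝ p q ∩ X ⊆ {q}) (hp : p ∉ X) (hz : z ∉ X ∪ segment ℝ p q)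
    (hw : w ∉ X ∪ segment ℝ p q) (h : PolyJoined Xᶜ z w) :
    PolyJoined (X ∪ segment ℝ p q)ᶜ z w := by
  rcases h.diff_or_exists_mem (segment ℝ p q) with h' | ⟨g, hg, hgX, hzg⟩
  · rwa [compl_union]
  obtain ⟨r, hr, hball⟩ := Metric.isOpen_iff.1 hX.isOpen_compl p hp
  have hp0 := side_eq_zero_of_mem_segment (left_mem_segment ℝ p q)
  obtain ⟨c, hc, hc0⟩ := exists_side_pos hpq hp0 (Metric.ball_mem_nhds p hr)
  have hcs : c ∉ segment ℝ p q := hc0.ne' ∘ side_eq_zero_of_mem_segment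
  have hdo : Disjoint (openSegment ℝ p q) X := disjoint_left.2 fun x hx hxX =>
    hpq (right_mem_openSegment_iff.1 (hd ⟨openSegment_subset_segment ℝ p q hx, hxX⟩ ▸ hx))
  have to_c : ∀ x ∉ X ∪ segment ℝ p q, PolyJoined Xᶜ x g →
      PolyJoined (X ∪ segment ℝ p q)ᶜ x c := fun x hx hxg => by
    refine (PolySaturated.setOf_polyJoined (X ∪ segment ℝ p q)ᶜ c).mem_of_polyJoined_segment hX hpq
      hdo ⟨left_mem_segment ℝ p q, hp⟩ ?_ hx ⟨hg, hgX⟩ hxg |>.2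
    refine mem_of_superset (Metric.ball_mem_nhds p hr) fun u hu =>
      or_iff_not_imp_right.2 fun hus => ⟨fun h => h.elim (hball hu) hus, ?_⟩
    exact polyJoined_around_left hpq (convex_ball p r) hball (Metric.ball_mem_nhds p hr) hu hus hc
      hcs
  exact (to_c z hz hzg).trans (to_c w hw (h.symm.trans hzg)).symm

theorem PolyJoined.eventually_union_segment_or (hX : IsClosed X) (hpq : p ≠ q)
    (hd : Disjoint (openSegment ℝ p q) X) (hm : m ∈ openSegment ℝ p q) {v : Plane}
    (hv : (side p q).linear v ≠ 0) :
    ∀ᶠ t in 𝓝[>] (0 : ℝ), ∀ z ∉ X ∪ segment ℝ p q, PolyJoined Xᶜ z m →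
      PolyJoined (X ∪ segment ℝ p q)ᶜ z (m + t • v) ∨
      PolyJoined (X ∪ segment ℝ p q)ᶜ z (m - t • v) := by
  have hms := openSegment_subset_segment ℝ p q hm
  have hm0 := side_eq_zero_of_mem_segment hms
  have hmX := disjoint_left.1 hd hm
  obtain ⟨r, hr, hball⟩ := Metric.isOpen_iff.1 hX.isOpen_compl m hmX
  have hplus := eventually_add_smul_mem (Metric.ball_mem_nhds m hr) v
  have hminus := eventually_add_smul_mem (Metric.ball_mem_nhds m hr) (-v)
  simp only [smul_neg, ← sub_eq_add_neg] at hminus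
  filter_upwards [self_mem_nhdsWithin, nhdsWithin_le_nhds hplus, nhdsWithin_le_nhds hminus]
    with t ht hplus hminus z hz hzm
  have near : ∀ x ∈ Metric.ball m r, x ∉ segment ℝ p q →
      PolyJoined (X ∪ segment ℝ p q)ᶜ x (m + t • v) ∨
      PolyJoined (X ∪ segment ℝ p q)ᶜ x (m - t • v) := by
    intro x hx hxs
    rcases hv.lt_or_gt with hv | hv
    · refine (polyJoined_or_of_side (convex_ball m r) hball hx hxs hminus ?_ hplus ?_).symm
      · rw [side_sub_smul hm0, neg_pos]; exact mul_neg_of_pos_of_neg ht hv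
      · rw [side_add_smul hm0]; exact mul_neg_of_pos_of_neg ht hv
    · refine polyJoined_or_of_side (convex_ball m r) hball hx hxs hplus ?_ hminus ?_
      · rw [side_add_smul hm0]; exact mul_pos ht hv
      · rw [side_sub_smul hm0, neg_neg_iff_pos]; exact mul_pos ht hv
  have hW := (PolySaturated.setOf_polyJoined (X ∪ segment ℝ p q)ᶜ (m + t • v)).union
    (.setOf_polyJoined (X ∪ segment ℝ p q)ᶜ (m - t • v))
  refine (hW.mem_of_polyJoined_segment hX hpq hd ⟨hms, hmX⟩ ?_ hz ⟨hms, hmX⟩ hzm).imp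
    (·.2) (·.2)
  refine mem_of_superset (Metric.ball_mem_nhds m hr) fun x hx =>
    or_iff_not_imp_right.2 fun hxs => ?_
  have hxY : x ∈ (X ∪ segment ℝ p q)ᶜ := fun h => h.elim (hball hx) hxs
  exact (near x hx hxs).imp (⟨hxY, ·⟩) (⟨hxY, ·⟩)

end Spread

section ViewAngle

variable {X : Set Plane} {a b p q m z : Plane}

/-- The identification of the plane with the complex numbers. -/
noncomputable def toComplex : Plane ≃L[ℝ] ℂ := Complex.equivRealProdCLM.symm

theorem toComplex_sub_ne_zero (h : z ≠ a) : toComplex a - toComplex z ≠ 0 :=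
  sub_ne_zero.2 fun h' => h (toComplex.injective h').symm

/-- The quotient of the complex numbers pointing from `z` to `b` and from `z` to `a`; its argument
is the angle under which the directed segment from `a` to `b` is seen from `z`. -/
noncomputable def viewRatio (a b z : Plane) : ℂ :=
  (toComplex b - toComplex z) / (toComplex a - toComplex z)

theorem continuousAt_viewRatio (ha : z ≠ a) : ContinuousAt (viewRatio a b) z := by
  have := toComplex.continuous
  exact ContinuousAt.div (by fun_prop) (by fun_prop) (toComplex_sub_ne_zero ha)

open scoped ComplexOrder in
theorem viewRatio_mem_slitPlane (hz : z ∉ segment ℝ a b) :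
    viewRatio a b z ∈ Complex.slitPlane := by
  rw [Complex.mem_slitPlane_iff_not_le_zero]
  refine fun h => hz (mem_segment_iff_sameRay.2 ?_)
  rw [← toComplex.injective.sameRay_map_iff, map_sub, map_sub, SameRay.sameRay_comm,
    Complex.sameRay_iff_arg_div_eq_zero, Complex.arg_eq_zero_iff_zero_le]
  have : (toComplex b - toComplex z) / (toComplex z - toComplex a) = -viewRatio a b z := by
    rw [viewRatio, ← neg_sub (toComplex a), div_neg]
  rw [this]
  exact neg_nonneg.2 h

theorem viewRatio_re_neg (hpq : p ≠ q) (hm : m ∈ openSegment ℝ p q) : (viewRatio p q m).re < 0 := by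
  obtain ⟨s, t, hs, ht, hst, rfl⟩ := hm
  have hp : toComplex p - toComplex (s • p + t • q) = t * (toComplex p - toComplex q) := by
    rw [← eq_sub_iff_add_eq] at hst
    simp only [hst, map_add, map_smul, Complex.real_smul, Complex.ofReal_sub, Complex.ofReal_one]
    ring
  have hq : toComplex q - toComplex (s • p + t • q) = -s * (toComplex p - toComplex q) := by
    rw [← eq_sub_iff_add_eq'] at hst
    simp only [hst, map_add, map_smul, Complex.real_smul, Complex.ofReal_sub, Complex.ofReal_one,
      neg_mul]
    ring
  rw [viewRatio, hp, hq, mul_div_mul_right _ _ (toComplex_sub_ne_zero hpq.symm),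
    ← Complex.ofReal_neg, ← Complex.ofReal_div, Complex.ofReal_re]
  exact div_neg_of_neg_of_pos (neg_neg_of_pos hs) ht

theorem viewRatio_im (p q z : Plane) :
    (viewRatio p q z).im = side p q z / Complex.normSq (toComplex p - toComplex z) := by
  have hside : side p q z = (toComplex q - toComplex z).im * (toComplex p - toComplex z).re -
      (toComplex q - toComplex z).re * (toComplex p - toComplex z).im := by
    simp [side_apply, toComplex]
    ring
  rw [viewRatio, Complex.div_im, ← sub_div, hside]

/-- The angle under which the directed segment from `a` to `b` is seen from `z`, in `(-π, π]`. -/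
noncomputable def viewAngle (a b z : Plane) : ℝ := (viewRatio a b z).arg

theorem viewAngle_coe (ha : z ≠ a) (hb : z ≠ b) : (viewAngle a b z : Real.Angle) =
    (toComplex b - toComplex z).arg - (toComplex a - toComplex z).arg :=
  Complex.arg_div_coe_angle (toComplex_sub_ne_zero hb) (toComplex_sub_ne_zero ha)

theorem continuousAt_viewAngle (hz : z ∉ segment ℝ a b) : ContinuousAt (viewAngle a b) z :=
  (Complex.continuousAt_arg (viewRatio_mem_slitPlane hz)).comp
    (continuousAt_viewRatio fun h => hz (h ▸ left_mem_segment ℝ a b))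

theorem eventually_pi_div_two_lt_viewAngle (hpq : p ≠ q) (hm : m ∈ openSegment ℝ p q) :
    ∀ᶠ z in 𝓝 m, (0 < side p q z → Real.pi / 2 < viewAngle p q z) ∧
      (side p q z < 0 → viewAngle p q z < -(Real.pi / 2)) := by
  have hmp : m ≠ p := fun h => hpq (left_mem_openSegment_iff.1 (h ▸ hm))
  filter_upwards [(Complex.continuous_re.continuousAt.comp (continuousAt_viewRatio hmp)).eventually
    (gt_mem_nhds (viewRatio_re_neg hpq hm)), isOpen_ne.mem_nhds hmp] with z hz hzp
  have hn := Complex.normSq_pos.2 (toComplex_sub_ne_zero hzp)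
  refine ⟨fun hs => ?_, fun hs => ?_⟩
  · rw [viewAngle, ← not_le, Complex.arg_le_pi_div_two_iff, not_or, not_le, not_lt, viewRatio_im]
    exact ⟨hz, (div_pos hs hn).le⟩
  · rw [viewAngle, ← not_le, Complex.neg_pi_div_two_le_arg_iff, not_or, not_le, not_le,
      viewRatio_im]
    exact ⟨hz, div_neg_of_neg_of_pos hs hn⟩

theorem PolyJoined.exists_angle (h : PolyJoined X a b) :
    ∃ θ : Plane → ℝ, ∀ z ∉ X, ContinuousAt θ z ∧ (θ z : Real.Angle) =
      (toComplex b - toComplex z).arg - (toComplex a - toComplex z).arg := by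
  induction h with
  | refl => exact ⟨fun _ => 0, fun z _ => ⟨continuousAt_const, by simp⟩⟩
  | @tail x y _ hxy ih =>
    obtain ⟨θ, hθ⟩ := ih
    refine ⟨fun z => viewAngle x y z + θ z, fun z hz => ?_⟩
    have hzs : z ∉ segment ℝ x y := fun h => hz (hxy h)
    refine ⟨(continuousAt_viewAngle hzs).add (hθ z hz).1, ?_⟩
    rw [Real.Angle.coe_add, (hθ z hz).2,
      viewAngle_coe (ne_of_mem_of_not_mem (left_mem_segment ℝ x y) hzs).symm
        (ne_of_mem_of_not_mem (right_mem_segment ℝ x y) hzs).symm, sub_add_sub_cancel]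

-- The total angle under which the closed polygon is seen is a multiple of `2π` and continuous off
-- the polygon, but it changes by more than `π` when the segment is crossed at `m`.
theorem PolyJoined.eventually_not_polyJoined_union_segment (h : PolyJoined X p q) (hpq : p ≠ q)
    (hm : m ∈ openSegment ℝ p q) (hmX : m ∉ X) :
    ∀ᶠ zw in 𝓝 m ×ˢ 𝓝 m, 0 < side p q zw.1 → side p q zw.2 < 0 →
      ¬ PolyJoined (X ∪ segment ℝ p q)ᶜ zw.1 zw.2 := by
  obtain ⟨θ, hθ⟩ := h.symm.exists_angle
  have hcont : ContinuousOn (viewAngle p q + θ) (X ∪ segment ℝ p q)ᶜ := fun z hz =>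
    ((continuousAt_viewAngle fun h => hz (.inr h)).add
      (hθ z fun h => hz (.inl h)).1).continuousWithinAt
  have hmul : MapsTo (viewAngle p q + θ) (X ∪ segment ℝ p q)ᶜ
      (AddSubgroup.zmultiples (2 * Real.pi)) := by
    intro z hz
    have hzs : z ∉ segment ℝ p q := fun h => hz (.inr h)
    rw [SetLike.mem_coe, AddSubgroup.mem_zmultiples_iff, ← Real.Angle.coe_eq_zero_iff, Pi.add_apply,
      Real.Angle.coe_add, (hθ z fun h => hz (.inl h)).2,
      viewAngle_coe (ne_of_mem_of_not_mem (left_mem_segment ℝ p q) hzs).symm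
        (ne_of_mem_of_not_mem (right_mem_segment ℝ p q) hzs).symm, sub_add_sub_cancel, sub_self]
  have hnear := (eventually_pi_div_two_lt_viewAngle hpq hm).and
    ((hθ m hmX).1.eventually (Metric.ball_mem_nhds _ one_pos))
  filter_upwards [prod_mem_prod hnear hnear]
  rintro ⟨z, w⟩ ⟨⟨hz, hzθ⟩, ⟨hw, hwθ⟩⟩ hz0 hw0 hzw
  have heq := hzw.eq_of_mapsTo_discrete hcont
    (SetLike.isDiscrete_iff_discreteTopology.2 inferInstance) hmul
  rw [Real.dist_eq, abs_lt] at hzθ hwθ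
  simp only [Pi.add_apply] at heq
  linarith [hz.1 hz0, hw.2 hw0, Real.pi_gt_three]

end ViewAngle

section Segment

variable {E : Type*} [AddCommGroup E] [Module ℝ E] {K : Set E} {m p q x y : E}

theorem segment_subset_segment_diff_left (hx : x ∈ segment ℝ p q) (hxp : x ≠ p) :
    segment ℝ x q ⊆ segment ℝ p q \ {p} := by
  refine fun z hz => ⟨(convex_segment p q).segment_subset hx (right_mem_segment ℝ p q) hz, ?_⟩
  rintro rfl
  exact hxp ((mem_segment_iff_wbtw.1 hx).swap_left_iff.1 (mem_segment_iff_wbtw.1 hz)).symm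

theorem segment_union_segment (hm : m ∈ segment ℝ p q) :
    segment ℝ p m ∪ segment ℝ m q = segment ℝ p q := by
  refine (union_subset ?_ ?_).antisymm fun x hx => ?_
  · exact (convex_segment p q).segment_subset (left_mem_segment ℝ p q) hm
  · exact (convex_segment p q).segment_subset hm (right_mem_segment ℝ p q)
  obtain ⟨t, ht, rfl⟩ := mem_segment_iff_wbtw.1 hm
  obtain ⟨s, hs, rfl⟩ := mem_segment_iff_wbtw.1 hx
  simp only [mem_union, mem_segment_iff_wbtw]
  rcases le_total s t with h | h
  · have : Wbtw ℝ 0 s t := mem_segment_iff_wbtw.1 (segment_eq_Icc ht.1 ▸ ⟨hs.1, h⟩)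
    exact .inl (by simpa using this.map (AffineMap.lineMap p q))
  · have : Wbtw ℝ t s 1 := mem_segment_iff_wbtw.1 (segment_eq_Icc ht.2 ▸ ⟨h, hs.2⟩)
    exact .inr (by simpa using this.map (AffineMap.lineMap p q))

theorem exists_segment_inter_eq_singleton [TopologicalSpace E] [ContinuousAdd E]
    [ContinuousSMul ℝ E] (hK : IsClosed K) (hy : y ∈ K) :
    ∃ w ∈ segment ℝ x y, segment ℝ x w ∩ K = {w} := by
  have hcomp : IsCompact (Icc (0 : ℝ) 1 ∩ (fun t : ℝ => x + t • (y - x)) ⁻¹' K) :=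
    isCompact_Icc.inter_right (hK.preimage (by fun_prop))
  obtain ⟨t, ⟨⟨h0, h1⟩, ht⟩, hmin⟩ := hcomp.exists_isLeast
    ⟨1, ⟨zero_le_one, le_rfl⟩, by simpa using hy⟩
  refine ⟨x + t • (y - x), segment_eq_image' ℝ x y ▸ ⟨t, ⟨h0, h1⟩, rfl⟩,
    Subset.antisymm ?_ (singleton_subset_iff.2 ⟨right_mem_segment ℝ _ _, ht⟩)⟩
  rintro z ⟨hz, hzK⟩
  rw [segment_eq_image'] at hz
  obtain ⟨s, ⟨s0, s1⟩, rfl⟩ := hz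
  have hst : x + s • (x + t • (y - x) - x) = x + (s * t) • (y - x) := by module
  simp only [hst] at hzK ⊢
  have hle : t ≤ s * t := hmin ⟨⟨mul_nonneg s0 h0, mul_le_one₀ s1 h0 h1⟩, hzK⟩
  rw [(mul_le_of_le_one_left h0 s1).antisymm hle]
  rfl

end Segment

section Carrier

variable {X S : Set Plane} {a b p q w x y z : Plane} {l l₁ l₂ : List Plane}

theorem carrier_cons_cons (p q : Plane) (l : List Plane) :
    carrier (p :: q :: l) = segment ℝ p q ∪ carrier (q :: l) := rfl

theorem carrier_singleton (p : Plane) : carrier [p] = {p} := rfl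

theorem carrier_pair (p q : Plane) : carrier [p, q] = segment ℝ p q :=
  union_eq_self_of_subset_right (singleton_subset_iff.2 (right_mem_segment ℝ p q))

theorem head_mem_carrier (p : Plane) (l : List Plane) : p ∈ carrier (p :: l) := by
  cases l with
  | nil => rfl
  | cons q l => exact .inl (left_mem_segment ℝ p q)

theorem carrier_append (l₁ : List Plane) (x : Plane) (l₂ : List Plane) :
    carrier (l₁ ++ x :: l₂) = carrier (l₁ ++ [x]) ∪ carrier (x :: l₂) := by
  have hx : {x} ⊆ carrier (x :: l₂) := singleton_subset_iff.2 (head_mem_carrier x l₂)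
  induction l₁ with
  | nil => exact (union_eq_self_of_subset_left hx).symm
  | cons a l₁ ih =>
    cases l₁ with
    | nil =>
      simp only [List.cons_append, List.nil_append, carrier_cons_cons, carrier_singleton,
        union_assoc, union_eq_self_of_subset_left hx]
    | cons b l₁ =>
      simp only [List.cons_append, carrier_cons_cons, union_assoc] at ih ⊢
      rw [ih]

theorem carrier_reverse (l : List Plane) : carrier l.reverse = carrier l := by
  induction l with
  | nil => rfl
  | cons p l ih =>
    cases l with
    | nil => rfl
    | cons q l =>
      rw [List.reverse_cons] at ih
      rw [List.reverse_cons, List.reverse_cons, List.append_assoc, List.singleton_append,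
        carrier_append, ih, carrier_pair, segment_symm, union_comm, carrier_cons_cons]

theorem mem_carrier_of_head? (h : l.head? = some a) : a ∈ carrier l := by
  obtain ⟨l, rfl⟩ := List.head?_eq_some_iff.1 h
  exact head_mem_carrier a l

theorem mem_carrier_of_getLast? (h : l.getLast? = some b) : b ∈ carrier l := by
  rw [← carrier_reverse]
  exact mem_carrier_of_head? (by rwa [List.head?_reverse])

theorem isCompact_carrier (l : List Plane) : IsCompact (carrier l) := by
  induction l with
  | nil => exact isCompact_empty
  | cons p l ih =>
    cases l with
    | nil => exact isCompact_singleton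
    | cons q l => exact (isCompact_segment p q).union ih

theorem isClosed_carrier (l : List Plane) : IsClosed (carrier l) := (isCompact_carrier l).isClosed

theorem isSimple_cons_cons : IsSimple (p :: q :: l) ↔
    p ≠ q ∧ segment ℝ p q ∩ carrier (q :: l) ⊆ {q} ∧ IsSimple (q :: l) := by
  have hq : {q} ⊆ segment ℝ p q ∩ carrier (q :: l) :=
    singleton_subset_iff.2 ⟨right_mem_segment ℝ p q, head_mem_carrier q l⟩
  exact and_congr_right' (and_congr_left' (Subset.antisymm_iff.trans (and_iff_left hq)))

theorem isSimple_pair : IsSimple [p, q] ↔ p ≠ q := by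
  rw [isSimple_cons_cons, carrier_singleton]
  exact and_iff_left ⟨inter_subset_right, trivial⟩

theorem IsSimple.notMem_carrier_tail (h : IsSimple (a :: l)) : a ∉ carrier l := by
  cases l with
  | nil => exact id
  | cons q l => exact fun ha => h.1 (h.2.1.subset ⟨left_mem_segment ℝ a q, ha⟩)

theorem isSimple_append : IsSimple (l₁ ++ x :: l₂) ↔ IsSimple (l₁ ++ [x]) ∧ IsSimple (x :: l₂) ∧
    carrier (l₁ ++ [x]) ∩ carrier (x :: l₂) ⊆ {x} := by
  induction l₁ with
  | nil => exact ⟨fun h => ⟨trivial, h, inter_subset_left⟩, fun h => h.2.1⟩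
  | cons a l₁ ih =>
    cases l₁ with
    | nil =>
      simp only [List.cons_append, List.nil_append]
      rw [isSimple_cons_cons, isSimple_pair, carrier_pair]
      tauto
    | cons b l₁ =>
      simp only [List.cons_append] at ih ⊢
      rw [isSimple_cons_cons, isSimple_cons_cons, ih, ← List.cons_append, carrier_append,
        carrier_cons_cons, inter_union_distrib_left, union_inter_distrib_right, union_subset_iff,
        union_subset_iff]
      have hb := head_mem_carrier b (l₁ ++ [x])
      have hx : x ∈ carrier (b :: (l₁ ++ [x])) :=
        mem_carrier_of_getLast? (by rw [← List.cons_append, List.getLast?_concat])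
      constructor
      · rintro ⟨hab, ⟨h1, h2⟩, hs1, hs2, h12⟩
        exact ⟨⟨hab, h1, hs1⟩, hs2, fun y hy => h12 ⟨h2 hy ▸ hb, hy.2⟩, h12⟩
      · rintro ⟨⟨hab, h1, hs1⟩, hs2, h2, h12⟩
        exact ⟨hab, ⟨h1, fun y hy => h1 ⟨hy.1, h2 hy ▸ hx⟩⟩, hs1, hs2, h12⟩

theorem IsSimple.reverse (h : IsSimple l) : IsSimple l.reverse := by
  induction l with
  | nil => trivial
  | cons p l ih =>
    cases l with
    | nil => trivial
    | cons q l =>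
      obtain ⟨hpq, hs, hl⟩ := isSimple_cons_cons.1 h
      rw [List.reverse_cons, List.reverse_cons, List.append_assoc, List.singleton_append,
        isSimple_append, ← List.reverse_cons, carrier_reverse, carrier_pair, segment_symm,
        inter_comm, isSimple_pair]
      exact ⟨ih hl, hpq.symm, hs⟩

theorem polyJoined_head_carrier (hx : x ∈ carrier (a :: l)) :
    PolyJoined (carrier (a :: l)) a x := by
  induction l generalizing a with
  | nil => rw [mem_singleton_iff.1 hx]; exact .refl _
  | cons q l ih =>
    rcases hx with hx | hx
    · exact .of_convex (convex_segment a q) subset_union_left (left_mem_segment ℝ a q) hx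
    · exact (PolyJoined.of_segment subset_union_left).trans ((ih hx).mono subset_union_right)

theorem polyJoined_of_mem_carrier (hx : x ∈ carrier l) (hy : y ∈ carrier l) :
    PolyJoined (carrier l) x y := by
  cases l with
  | nil => exact hx.elim
  | cons a l => exact (polyJoined_head_carrier hx).symm.trans (polyJoined_head_carrier hy)

theorem IsSimple.polyJoined_carrier_diff_head (hl : IsSimple l) (ha : l.head? = some a)
    (hx : x ∈ carrier l) (hxa : x ≠ a) (hy : y ∈ carrier l) (hya : y ≠ a) :
    PolyJoined (carrier l \ {a}) x y := by
  obtain ⟨l, rfl⟩ := List.head?_eq_some_iff.1 ha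
  cases l with
  | nil => exact absurd hx hxa
  | cons q l =>
    have to_q : ∀ x ∈ carrier (a :: q :: l), x ≠ a →
        PolyJoined (carrier (a :: q :: l) \ {a}) x q := by
      rintro x (hx | hx) hxa
      · exact .of_segment ((segment_subset_segment_diff_left hx hxa).trans
          (sdiff_subset_sdiff_left subset_union_left))
      · have ha : a ∉ carrier (q :: l) := hl.notMem_carrier_tail
        exact ((polyJoined_head_carrier hx).mono
          (subset_sdiff_singleton subset_union_right ha)).symm
    exact (to_q x hx hxa).trans (to_q y hy hya).symm

theorem IsSimple.polyJoined_carrier_diff_last (hl : IsSimple l) (hb : l.getLast? = some b)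
    (hx : x ∈ carrier l) (hxb : x ≠ b) (hy : y ∈ carrier l) (hyb : y ≠ b) :
    PolyJoined (carrier l \ {b}) x y := by
  rw [← carrier_reverse] at hx hy ⊢
  exact hl.reverse.polyJoined_carrier_diff_head (by rwa [List.head?_reverse]) hx hxb hy hyb

theorem PolyJoined.union_carrier_of_head (hX : IsClosed X) (hl : IsSimple l)
    (ha : l.head? = some a) (haX : a ∈ X) (hd : carrier l ∩ X ⊆ {a}) (hz : z ∉ X ∪ carrier l)
    (hw : w ∉ X ∪ carrier l) (h : PolyJoined Xᶜ z w) : PolyJoined (X ∪ carrier l)ᶜ z w := by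
  obtain ⟨l, rfl⟩ := List.head?_eq_some_iff.1 ha
  clear ha
  induction l generalizing a X with
  | nil => rwa [carrier_singleton, union_eq_self_of_subset_right (singleton_subset_iff.2 haX)]
  | cons q l ih =>
    obtain ⟨haq, hs, hl⟩ := isSimple_cons_cons.1 hl
    rw [carrier_cons_cons, union_inter_distrib_right, union_subset_iff] at hd
    rw [carrier_cons_cons, ← union_assoc] at hz hw ⊢
    rw [segment_symm] at hd hz hw
    have hqX : q ∉ X := fun hq => haq (hd.1 ⟨left_mem_segment ℝ q a, hq⟩).symm
    have hq := h.union_segment_of_free hX haq.symm hd.1 hqX (hz ∘ .inl) (hw ∘ .inl)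
    rw [segment_symm] at hd hz hw hq
    refine ih (hX.union (isClosed_segment a q)) (haX := .inr (right_mem_segment ℝ a q)) (h := hq)
      (hl := hl) (hz := hz) (hw := hw) (hd := ?_)
    rintro x ⟨hx, hxX | hxs⟩
    · exact hs ⟨hd.2 ⟨hx, hxX⟩ ▸ left_mem_segment ℝ a q, hx⟩
    · exact hs ⟨hxs, hx⟩

theorem PolyJoined.union_carrier_of_getLast? (hX : IsClosed X) (hl : IsSimple l)
    (hb : l.getLast? = some b) (hbX : b ∈ X) (hd : carrier l ∩ X ⊆ {b}) (hz : z ∉ X ∪ carrier l)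
    (hw : w ∉ X ∪ carrier l) (h : PolyJoined Xᶜ z w) : PolyJoined (X ∪ carrier l)ᶜ z w := by
  rw [← carrier_reverse] at hd hz hw ⊢
  exact h.union_carrier_of_head hX hl.reverse (by rwa [List.head?_reverse]) hbX hd hz hw

theorem IsSimple.exists_suffix_of_mem_carrier (hl : IsSimple l) (hw : w ∈ carrier l) :
    ∃ l', IsSimple (w :: l') ∧ (w :: l').getLast? = l.getLast? ∧
      carrier (w :: l') ⊆ carrier l := by
  induction l with
  | nil => exact hw.elim
  | cons p l ih =>
    cases l with
    | nil => exact ⟨[], trivial, by rw [mem_singleton_iff.1 hw], by rw [mem_singleton_iff.1 hw]⟩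
    | cons q l =>
      obtain ⟨-, hs, hl⟩ := isSimple_cons_cons.1 hl
      by_cases hwl : w ∈ carrier (q :: l)
      · obtain ⟨l', hl', hlast, hsub⟩ := ih hl hwl
        exact ⟨l', hl', by rwa [List.getLast?_cons_cons], hsub.trans subset_union_right⟩
      · have hsub : segment ℝ w q ⊆ segment ℝ p q := (convex_segment p q).segment_subset
          (hw.resolve_right hwl) (right_mem_segment ℝ p q)
        exact ⟨q :: l, isSimple_cons_cons.2 ⟨fun h => hwl (h ▸ head_mem_carrier q l),
          (inter_subset_inter_left _ hsub).trans hs, hl⟩, by simp only [List.getLast?_cons_cons],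
          union_subset_union_left _ hsub⟩

-- Loops are cut off by following each new segment only up to its first point on the simple curve
-- constructed so far.
theorem PolyJoined.exists_isSimple (h : PolyJoined S a b) (hb : b ∈ S) :
    ∃ l, IsSimple (a :: l) ∧ (a :: l).getLast? = some b ∧ carrier (a :: l) ⊆ S := by
  induction h using Relation.ReflTransGen.head_induction_on with
  | refl => exact ⟨[], trivial, rfl, singleton_subset_iff.2 hb⟩
  | @head x y hxy _ ih =>
    obtain ⟨l, hl, hlast, hlS⟩ := ih
    obtain ⟨w, hw, hxw⟩ := exists_segment_inter_eq_singleton (x := x) (isClosed_carrier (y :: l))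
      (head_mem_carrier y l)
    obtain ⟨l', hl', hlast', hsub⟩ := hl.exists_suffix_of_mem_carrier (hxw.superset rfl).2
    rcases eq_or_ne x w with rfl | hne
    · exact ⟨l', hl', hlast'.trans hlast, hsub.trans hlS⟩
    · have hxwS : segment ℝ x w ⊆ S :=
        ((convex_segment x y).segment_subset (left_mem_segment ℝ x y) hw).trans hxy
      exact ⟨w :: l', isSimple_cons_cons.2 ⟨hne, (inter_subset_inter_right _ hsub).trans hxw.subset,
        hl'⟩, by rw [List.getLast?_cons_cons, hlast', hlast], union_subset hxwS (hsub.trans hlS)⟩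

end Carrier

section Crossbar

variable {E : Type*} [AddCommGroup E] [Module ℝ E] {m p q : E}

theorem eventually_add_smul_mem_segment (hm : m ∈ openSegment ℝ p q) :
    ∀ᶠ u in 𝓝 (0 : ℝ), m + u • (q - p) ∈ segment ℝ p q := by
  rw [openSegment_eq_image'] at hm
  obtain ⟨t, ⟨h0, h1⟩, rfl⟩ := hm
  filter_upwards [Ioo_mem_nhds (neg_lt_zero.2 h0) (sub_pos.2 h1)] with u hu
  rw [segment_eq_image']
  exact ⟨t + u, ⟨by linarith [hu.1], by linarith [hu.2]⟩, by module⟩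

theorem eventually_add_smul_mem_segment_right (hm : m ∈ openSegment ℝ p q) (hpq : p ≠ q) :
    ∀ᶠ u in 𝓝[>] (0 : ℝ), m + u • (q - p) ∈ segment ℝ m q \ {m} := by
  rw [openSegment_eq_image'] at hm
  obtain ⟨t, ⟨-, h1⟩, rfl⟩ := hm
  filter_upwards [Ioo_mem_nhdsGT (sub_pos.2 h1)] with u hu
  refine ⟨?_, by simpa [sub_eq_zero, hu.1.ne'] using hpq.symm⟩
  rw [segment_eq_image']
  refine ⟨u / (1 - t), ⟨div_nonneg hu.1.le (sub_pos.2 h1).le,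
    div_le_one_of_le₀ hu.2.le (sub_pos.2 h1).le⟩, ?_⟩
  have hq : q - (p + t • (q - p)) = (1 - t) • (q - p) := by module
  simp only [hq, smul_smul, div_mul_cancel₀ u (sub_pos.2 h1).ne']

theorem exists_smul_eq_of_side_linear_eq_zero {p q v : Plane} (hpq : p ≠ q)
    (hv : (side p q).linear v = 0) : ∃ k : ℝ, v = k • (q - p) := by
  have hv' : (q.1 - p.1) * v.2 - (q.2 - p.2) * v.1 = 0 := hv
  rcases eq_or_ne q.1 p.1 with h1 | h1
  · have h2 : q.2 - p.2 ≠ 0 := fun h2 => hpq (Prod.ext h1.symm (sub_eq_zero.1 h2).symm)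
    refine ⟨v.2 / (q.2 - p.2), Prod.ext ?_ (div_mul_cancel₀ _ h2).symm⟩
    simp_all
  · have h1 := sub_ne_zero.2 h1
    refine ⟨v.1 / (q.1 - p.1), Prod.ext (div_mul_cancel₀ _ h1).symm ?_⟩
    simp only [Prod.smul_snd, Prod.snd_sub, smul_eq_mul]
    field_simp
    linarith

end Crossbar

/-- A curve `A, p, q, B` from `s` to `t` in the complement of a closed set `X`, except for its two
ends, which lie in `X`, together with a crossbar from `c` to `d` at a point `m` inside the segment
from `p` to `q`. The two halves of the curve are allowed to have their ends in `X` in common, so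
that the curve may be closed. -/
structure Chord (X : Set Plane) (A B : List Plane) (s t p q m c d : Plane) : Prop where
  isClosed : IsClosed X
  left_mem : s ∈ X
  right_mem : t ∈ X
  head_eq : A.head? = some s
  last_eq : B.getLast? = some t
  isSimple_left : IsSimple (A ++ [p, m])
  isSimple_right : IsSimple (m :: q :: B)
  mem_openSegment : m ∈ openSegment ℝ p q
  mem_crossbar : m ∈ openSegment ℝ c d
  left_inter : carrier (A ++ [p, m]) ∩ X ⊆ {s}
  right_inter : carrier (m :: q :: B) ∩ X ⊆ {t}
  left_inter_right : ∀ x ∈ carrier (A ++ [p, m]), x ∈ carrier (m :: q :: B) →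
    x = m ∨ x = s ∧ x = t
  notMem : m ∉ X
  ne : c ≠ d
  crossbar_inter : segment ℝ c d ∩ (carrier (A ++ [p, m]) ∪ carrier (m :: q :: B)) ⊆ {m}

namespace Chord

variable {X O : Set Plane} {A B : List Plane} {s t p q m c d g x : Plane}

/-- The set of points of the curve of a chord. -/
def points (A B : List Plane) (p q m : Plane) : Set Plane :=
  carrier (A ++ [p, m]) ∪ carrier (m :: q :: B)

theorem isClosed_points (A B : List Plane) (p q m : Plane) : IsClosed (points A B p q m) :=
  (isClosed_carrier _).union (isClosed_carrier _)

theorem mem_points (A B : List Plane) (p q m : Plane) : m ∈ points A B p q m :=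
  .inr (head_mem_carrier _ _)

theorem carrier_left (A : List Plane) (p m : Plane) :
    carrier (A ++ [p, m]) = carrier (A ++ [p]) ∪ segment ℝ p m := by
  rw [carrier_append, carrier_pair]

theorem union_compl (h : Chord X A B s t p q m c d) (hO : IsOpen O) (hsub : points A B p q m ⊆ O) :
    Chord (X ∪ Oᶜ) A B s t p q m c d where
  __ := h
  isClosed := h.isClosed.union hO.isClosed_compl
  left_mem := .inl h.left_mem
  right_mem := .inl h.right_mem
  left_inter := fun _ hx => h.left_inter ⟨hx.1, hx.2.resolve_right (not_not.2 (hsub (.inl hx.1)))⟩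
  right_inter := fun _ hx => h.right_inter ⟨hx.1, hx.2.resolve_right (not_not.2 (hsub (.inr hx.1)))⟩
  notMem := fun hm => hm.elim h.notMem (not_not.2 (hsub (mem_points A B p q m)))

section

variable (h : Chord X A B s t p q m c d)
include h

theorem isSimple_left_split :
    IsSimple (A ++ [p]) ∧ p ≠ m ∧ carrier (A ++ [p]) ∩ segment ℝ p m ⊆ {p} := by
  simpa only [isSimple_append (l₂ := [m]), isSimple_pair, carrier_pair] using h.isSimple_left

theorem isSimple_right_split :
    m ≠ q ∧ segment ℝ m q ∩ carrier (q :: B) ⊆ {q} ∧ IsSimple (q :: B) :=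
  isSimple_cons_cons.1 h.isSimple_right

theorem left_mem_carrier : s ∈ carrier (A ++ [p]) :=
  mem_carrier_of_head? (by rw [List.head?_append, h.head_eq]; rfl)

theorem getLast?_right : (q :: B).getLast? = some t := by
  rw [List.getLast?_cons, h.last_eq]; rfl

theorem right_mem_carrier : t ∈ carrier (q :: B) := mem_carrier_of_getLast? h.getLast?_right

theorem notMem_left : m ∉ carrier (A ++ [p]) := fun hm =>
  h.isSimple_left_split.2.1 (h.isSimple_left_split.2.2 ⟨hm, right_mem_segment ℝ p m⟩).symm

theorem notMem_right : m ∉ carrier (q :: B) := h.isSimple_right.notMem_carrier_tail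

theorem ne_ends : p ≠ q := by
  rintro rfl
  exact h.isSimple_right_split.1 (by simpa using h.mem_openSegment)

theorem ne_of_mem_openSegment (hx : x ∈ openSegment ℝ p q) : x ≠ p ∧ x ≠ q :=
  ⟨fun e => h.ne_ends (left_mem_openSegment_iff.1 (e ▸ hx)),
    fun e => h.ne_ends (right_mem_openSegment_iff.1 (e ▸ hx))⟩

theorem segment_left_inter :
    segment ℝ p m ∩ (X ∪ carrier (A ++ [p]) ∪ carrier (q :: B)) ⊆ {p} := by
  rintro x ⟨hx, hx'⟩
  have hxA : x ∈ carrier (A ++ [p, m]) := carrier_left A p m ▸ .inr hx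
  refine h.isSimple_left_split.2.2 ⟨?_, hx⟩
  rcases hx' with (hxX | hxl) | hxr
  · exact h.left_inter ⟨hxA, hxX⟩ ▸ h.left_mem_carrier
  · exact hxl
  · rcases h.left_inter_right x hxA (.inr hxr) with rfl | ⟨rfl, -⟩
    exacts [absurd hxr h.notMem_right, h.left_mem_carrier]

theorem segment_right_inter :
    segment ℝ m q ∩ (X ∪ carrier (A ++ [p]) ∪ carrier (q :: B)) ⊆ {q} := by
  rintro x ⟨hx, hx'⟩
  refine h.isSimple_right_split.2.1 ⟨hx, ?_⟩
  rcases hx' with (hxX | hxl) | hxr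
  · exact h.right_inter ⟨.inl hx, hxX⟩ ▸ h.right_mem_carrier
  · rcases h.left_inter_right x (carrier_left A p m ▸ .inl hxl) (.inl hx) with rfl | ⟨-, rfl⟩
    exacts [absurd hxl h.notMem_left, h.right_mem_carrier]
  · exact hxr

theorem segment_union_segment :
    segment ℝ p m ∪ segment ℝ m q = segment ℝ p q :=
  BrusselsSprout.segment_union_segment (openSegment_subset_segment ℝ p q h.mem_openSegment)

theorem segment_subset_points : segment ℝ p q ⊆ points A B p q m := by
  rw [← h.segment_union_segment, points, carrier_left]
  exact union_subset_union subset_union_right subset_union_left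

theorem disjoint_openSegment :
    Disjoint (openSegment ℝ p q) (X ∪ carrier (A ++ [p]) ∪ carrier (q :: B)) := by
  refine disjoint_left.2 fun x hx hx' => ?_
  rcases h.segment_union_segment.superset (openSegment_subset_segment ℝ p q hx) with hl | hr
  · exact (h.ne_of_mem_openSegment hx).1 (h.segment_left_inter ⟨hl, hx'⟩)
  · exact (h.ne_of_mem_openSegment hx).2 (h.segment_right_inter ⟨hr, hx'⟩)

theorem isClosed_union : IsClosed (X ∪ carrier (A ++ [p]) ∪ carrier (q :: B)) :=
  (h.isClosed.union (isClosed_carrier _)).union (isClosed_carrier _)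

theorem union_segment_eq :
    X ∪ carrier (A ++ [p]) ∪ carrier (q :: B) ∪ segment ℝ p q = X ∪ points A B p q m := by
  rw [← h.segment_union_segment, points, carrier_left, carrier_cons_cons, union_assoc, union_assoc,
    union_comm (carrier (q :: B)), union_assoc, union_assoc]

theorem side_linear_ne_zero : (side p q).linear (d - c) ≠ 0 := by
  intro h0
  obtain ⟨k, hk⟩ := exists_smul_eq_of_side_linear_eq_zero h.ne_ends h0
  have hpq : ∀ᶠ u in 𝓝 (0 : ℝ), m + (u * k) • (q - p) ∈ segment ℝ p q :=
    ((continuous_mul_const k).tendsto' 0 0 (zero_mul k)).eventually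
      (eventually_add_smul_mem_segment h.mem_openSegment)
  obtain ⟨u, ⟨hu, hu'⟩, hu0⟩ := (((eventually_add_smul_mem_segment h.mem_crossbar).and hpq
    |>.filter_mono nhdsWithin_le_nhds).and (self_mem_nhdsWithin (s := Ioi 0))).exists
  have hum := h.crossbar_inter ⟨hu, h.segment_subset_points (by rwa [hk, smul_smul])⟩
  rw [mem_singleton_iff, add_eq_left, smul_eq_zero, sub_eq_zero] at hum
  exact hum.elim (ne_of_gt hu0) h.ne.symm

theorem eventually_mem_crossbar : ∀ᶠ u in 𝓝[>] (0 : ℝ),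
    m - u • (d - c) ∈ segment ℝ m c \ {m} ∧ m + u • (d - c) ∈ segment ℝ m d \ {m} := by
  have hc := eventually_add_smul_mem_segment_right (openSegment_symm ℝ c d ▸ h.mem_crossbar)
    h.ne.symm
  filter_upwards [hc, eventually_add_smul_mem_segment_right h.mem_crossbar h.ne] with u hc hd
  rw [sub_eq_add_neg, ← smul_neg, neg_sub]
  exact ⟨hc, hd⟩

theorem polyJoined_cross (hg : g ∈ points A B p q m) (hgX : g ∉ X) :
    PolyJoined (points A B p q m \ X) g m := by
  rcases hg with hg | hg
  · have hs : (A ++ [p, m]).head? = some s := by rw [List.head?_append, h.head_eq]; rfl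
    refine (h.isSimple_left.polyJoined_carrier_diff_head hs hg
      (ne_of_mem_of_not_mem h.left_mem hgX).symm (mem_carrier_of_getLast? (by simp))
      (ne_of_mem_of_not_mem h.left_mem h.notMem).symm).mono ?_
    exact fun x hx => ⟨.inl hx.1, fun hx' => hx.2 (h.left_inter ⟨hx.1, hx'⟩)⟩
  · have ht : (m :: q :: B).getLast? = some t := h.getLast?_right
    refine (h.isSimple_right.polyJoined_carrier_diff_last ht hg
      (ne_of_mem_of_not_mem h.right_mem hgX).symm (head_mem_carrier _ _)
      (ne_of_mem_of_not_mem h.right_mem h.notMem).symm).mono ?_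
    exact fun x hx => ⟨.inr hx.1, fun hx' => hx.2 (h.right_inter ⟨hx.1, hx'⟩)⟩

-- Only the segment between `p` and `q` can separate, and near it there is one tip on each side.
theorem exists_polyJoined_crossbar :
    ∃ c' ∈ segment ℝ m c \ {m}, ∃ d' ∈ segment ℝ m d \ {m},
      ∀ z ∉ X ∪ points A B p q m, ∀ g ∈ points A B p q m \ X, PolyJoined Xᶜ z g →
        PolyJoined (X ∪ points A B p q m)ᶜ z c' ∨ PolyJoined (X ∪ points A B p q m)ᶜ z d' := by
  obtain ⟨u, hor, hc, hd⟩ := ((PolyJoined.eventually_union_segment_or h.isClosed_union h.ne_ends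
    h.disjoint_openSegment h.mem_openSegment h.side_linear_ne_zero).and
    h.eventually_mem_crossbar).exists
  refine ⟨_, hc, _, hd, fun z hz g hg hzg => ?_⟩
  have hzm : PolyJoined Xᶜ z m := hzg.trans ((h.polyJoined_cross hg.1 hg.2).mono fun x hx => hx.2)
  rw [← h.union_segment_eq] at hz ⊢
  have hm := disjoint_left.1 h.disjoint_openSegment h.mem_openSegment
  refine (hor z hz ?_).symm
  have hleft : PolyJoined (X ∪ carrier (A ++ [p]))ᶜ z m := by
    refine hzm.union_carrier_of_head h.isClosed h.isSimple_left_split.1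
      (by rw [List.head?_append, h.head_eq]; rfl) h.left_mem ?_ (hz ∘ .inl ∘ .inl) (hm ∘ .inl)
    exact (inter_subset_inter_left _ (carrier_left A p m ▸ subset_union_left)).trans h.left_inter
  refine hleft.union_carrier_of_getLast? (h.isClosed.union (isClosed_carrier _))
    h.isSimple_right_split.2.2 h.getLast?_right (.inl h.right_mem) ?_ (hz ∘ .inl) hm
  rintro x ⟨hx, hxX | hxl⟩
  · exact h.right_inter ⟨.inr hx, hxX⟩
  · rcases h.left_inter_right x (carrier_left A p m ▸ .inl hxl) (.inr hx) with rfl | ⟨-, hxt⟩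
    exacts [absurd hx h.notMem_right, hxt]

theorem polyJoined_ends (hst : PolyJoined X s t) :
    PolyJoined (X ∪ carrier (A ++ [p]) ∪ carrier (q :: B)) p q := by
  have hp : p ∈ carrier (A ++ [p]) := mem_carrier_of_getLast? List.getLast?_concat
  exact ((polyJoined_of_mem_carrier hp h.left_mem_carrier).mono
      (subset_union_right.trans subset_union_left)).trans <|
    (hst.mono (subset_union_left.trans subset_union_left)).trans <|
    (polyJoined_of_mem_carrier h.right_mem_carrier (head_mem_carrier q B)).mono subset_union_right

theorem polyJoined_half {e e' : Plane} (he : segment ℝ m e ⊆ segment ℝ c d)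
    (heX : Disjoint (segment ℝ m e) X) (he' : e' ∈ segment ℝ m e \ {m}) :
    PolyJoined (X ∪ points A B p q m)ᶜ e' e :=
  .of_segment fun _ hx =>
    have hx := segment_subset_segment_diff_left he'.1 he'.2 hx
    fun hx' => hx'.elim (disjoint_left.1 heX hx.1) fun hx' =>
      hx.2 (h.crossbar_inter ⟨he hx.1, hx'⟩)

theorem not_polyJoined (hst : PolyJoined X s t) (hcd : Disjoint (segment ℝ c d) X) :
    ¬ PolyJoined (X ∪ points A B p q m)ᶜ c d := by
  intro hj
  have hmc := openSegment_subset_segment ℝ c d h.mem_crossbar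
  have hc := (convex_segment c d).segment_subset hmc (left_mem_segment ℝ c d)
  have hd := (convex_segment c d).segment_subset hmc (right_mem_segment ℝ c d)
  have hsep := (h.polyJoined_ends hst).eventually_not_polyJoined_union_segment h.ne_ends
    h.mem_openSegment (disjoint_left.1 h.disjoint_openSegment h.mem_openSegment)
  rw [h.union_segment_eq] at hsep
  have hadd : Tendsto (fun u : ℝ => m + u • (d - c)) (𝓝[>] 0) (𝓝 m) :=
    tendsto_nhdsWithin_of_tendsto_nhds (Continuous.tendsto' (by fun_prop) _ _ (by simp))
  have hsub : Tendsto (fun u : ℝ => m - u • (d - c)) (𝓝[>] 0) (𝓝 m) :=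
    tendsto_nhdsWithin_of_tendsto_nhds (Continuous.tendsto' (by fun_prop) _ _ (by simp))
  obtain ⟨u, ⟨⟨⟨hu1, hu2⟩, huc, hud⟩, hu0⟩⟩ := ((((hadd.prodMk hsub).eventually hsep).and
    ((hsub.prodMk hadd).eventually hsep)).and h.eventually_mem_crossbar |>.and
    (self_mem_nhdsWithin (s := Ioi (0 : ℝ)))).exists
  have hjoin := ((h.polyJoined_half hc (hcd.mono_left hc) huc).trans hj).trans
    (h.polyJoined_half hd (hcd.mono_left hd) hud).symm
  have hm := side_eq_zero_of_mem_segment (openSegment_subset_segment ℝ p q h.mem_openSegment)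
  rw [side_add_smul hm, side_sub_smul hm, neg_neg_iff_pos] at hu1
  rw [side_add_smul hm, side_sub_smul hm, neg_pos] at hu2
  rcases (mul_ne_zero (ne_of_gt hu0) h.side_linear_ne_zero).lt_or_gt with h0 | h0
  exacts [hu2 h0 h0 hjoin, hu1 h0 h0 hjoin.symm]

end

end Chord

/-- The complement of `X` has at most `N` faces: at most `N` points of it can be chosen no two of
which are joined in it. -/
def HasFacesLE (X : Set Plane) (N : ℕ) : Prop :=
  ∀ R : Finset Plane, (∀ z ∈ R, z ∉ X) →
    (R : Set Plane).Pairwise (fun z w => ¬ PolyJoined Xᶜ z w) → R.card ≤ N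

namespace HasFacesLE

variable {X Y : Set Plane} {N : ℕ}

theorem singleton (v : Plane) : HasFacesLE {v} 1 := by
  have hc : IsConnected ({v}ᶜ : Set Plane) :=
    isConnected_compl_singleton_of_one_lt_rank (by rw [rank_prod', Module.rank_self]; norm_num) v
  exact fun R hRX hR => Finset.card_le_one.2 fun z hz w hw => hR.eq hz hw <| not_not.2 <|
    .of_isPreconnected hc.isPreconnected isClosed_singleton.isOpen_compl (hRX z hz) (hRX w hw)

theorem mono_set (h : HasFacesLE X N) (hXY : X ⊆ Y)
    (hj : ∀ z ∉ Y, ∀ w ∉ Y, PolyJoined Xᶜ z w → PolyJoined Yᶜ z w) : HasFacesLE Y N :=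
  fun R hRY hR => h R (fun z hz => hRY z hz ∘ @hXY z) fun z hz w hw hzw =>
    hR hz hw hzw ∘ hj z (hRY z hz) w (hRY w hw)

theorem union_segment (h : HasFacesLE X N) (hX : IsClosed X) {p q : Plane} (hpq : p ≠ q)
    (hp : p ∈ X) (hq : q ∈ X) (hd : Disjoint (openSegment ℝ p q) X) :
    HasFacesLE (X ∪ segment ℝ p q) (N + 1) := by
  classical
  intro R hRX hR
  obtain ⟨m, hm⟩ : (openSegment ℝ p q).Nonempty := ⟨_, midpoint_mem_openSegment p q⟩
  obtain ⟨v, hv⟩ := exists_side_linear_pos hpq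
  obtain ⟨u, hu⟩ := (PolyJoined.eventually_union_segment_or hX hpq hd hm hv.ne').exists
  have hcut : {z ∈ R | PolyJoined Xᶜ z m}.card ≤ 2 := by
    refine (Finset.card_le_card_of_injOn (PolyJoined (X ∪ segment ℝ p q)ᶜ · (m + u • v))
      (fun _ _ => Finset.mem_univ _) fun z hz w hw hzw => ?_).trans_eq Fintype.card_prop
    obtain ⟨hzR, hzm⟩ := Finset.mem_filter.1 hz
    obtain ⟨hwR, hwm⟩ := Finset.mem_filter.1 hw
    refine hR.eq hzR hwR (not_not.2 ?_)
    by_cases hzu : PolyJoined (X ∪ segment ℝ p q)ᶜ z (m + u • v)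
    · exact hzu.trans (hzw.mp hzu).symm
    · exact ((hu z (hRX z hzR) hzm).resolve_left hzu).trans
        ((hu w (hRX w hwR) hwm).resolve_left (hzu ∘ hzw.mpr)).symm
  have hrest : (insert m {z ∈ R | ¬ PolyJoined Xᶜ z m}).card ≤ N := by
    have hsep : ∀ z, ¬ PolyJoined Xᶜ z m → ∀ w, PolyJoined Xᶜ z w →
        PolyJoined (X ∪ segment ℝ p q)ᶜ z w := by
      intro z hzm w hzw
      rw [compl_union]
      refine (hzw.diff_or_exists_mem (segment ℝ p q)).resolve_right ?_
      rintro ⟨g, hg, hgX, hzg⟩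
      refine hzm (hzg.trans (.of_convex (convex_openSegment p q) hd.subset_compl_right ?_ hm))
      exact mem_openSegment_of_ne_left_right (fun e => hgX (e ▸ hp)) (fun e => hgX (e ▸ hq)) hg
    refine h _ ?_ ?_
    · simp only [Finset.forall_mem_insert, Finset.mem_filter]
      exact ⟨disjoint_left.1 hd hm, fun z hz => hRX z hz.1 ∘ .inl⟩
    · rw [Finset.coe_insert, Finset.coe_filter]
      refine Set.Pairwise.insert (fun z hz w hw hzw hj => hR hz.1 hw.1 hzw (hsep z hz.2 w hj)) ?_
      exact fun z hz _ => ⟨hz.2 ∘ .symm, hz.2⟩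
  rw [Finset.card_insert_of_notMem (by simp [PolyJoined.refl])] at hrest
  have := R.card_filter_add_card_filter_not (PolyJoined Xᶜ · m)
  omega

theorem union_carrier (h : HasFacesLE X N) (hX : IsClosed X) {A : List Plane} (hA : IsArc A)
    {u w : Plane} (hu : A.head? = some u) (hw : A.getLast? = some w) (huX : u ∈ X) (hwX : w ∈ X)
    (hd : carrier A ∩ X ⊆ {u, w}) : HasFacesLE (X ∪ carrier A) (N + 1) := by
  obtain ⟨hlen, hs⟩ := hA
  match A, hlen with
  | p :: q :: l, _ =>
    obtain rfl : p = u := by simpa using hu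
    have hp := hs.notMem_carrier_tail
    obtain ⟨hpq, hi, hs⟩ := isSimple_cons_cons.1 hs
    have hw : (q :: l).getLast? = some w := by simpa using hw
    rw [carrier_cons_cons, union_comm (segment ℝ p q), ← union_assoc]
    refine union_segment ?_ (hX.union (isClosed_carrier _)) hpq (.inl huX)
      (.inr (head_mem_carrier _ _)) (disjoint_left.2 fun x hx hx' => ?_)
    · refine h.mono_set subset_union_left fun z hz y hy hzy =>
        hzy.union_carrier_of_getLast? hX hs hw hwX ?_ hz hy
      exact fun x hx => (hd ⟨.inr hx.1, hx.2⟩).resolve_left fun e => hp (e ▸ hx.1)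
    · have hxs := openSegment_subset_segment ℝ p q hx
      have hxp : x ≠ p := fun e => hpq (left_mem_openSegment_iff.1 (e ▸ hx))
      have hxl : x ∈ carrier (q :: l) := hx'.elim (fun hxX =>
        (hd ⟨.inl hxs, hxX⟩).resolve_left hxp ▸ mem_carrier_of_getLast? hw) id
      exact hpq (right_mem_openSegment_iff.1 (hi ⟨hxs, hxl⟩ ▸ hx))

theorem union_carrier_of_leaf (h : HasFacesLE X N) (hX : IsClosed X) {A : List Plane}
    (hA : IsSimple A) {u : Plane} (hu : A.head? = some u ∨ A.getLast? = some u) (huX : u ∈ X)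
    (hd : carrier A ∩ X ⊆ {u}) : HasFacesLE (X ∪ carrier A) N :=
  h.mono_set subset_union_left fun _ hz _ hw hzw => hu.elim
    (fun hu => hzw.union_carrier_of_head hX hA hu huX hd hz hw)
    (fun hu => hzw.union_carrier_of_getLast? hX hA hu huX hd hz hw)

end HasFacesLE

/-- The union of the given curves. -/
def carriers (L : List (List Plane)) : Set Plane := {x | ∃ A ∈ L, x ∈ carrier A}

theorem isCompact_carriers (L : List (List Plane)) : IsCompact (carriers L) := by
  have hL : carriers L = ⋃ A ∈ {A | A ∈ L}, carrier A := by
    ext; simp only [carriers, mem_ofPred_eq, mem_iUnion, exists_prop]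
  exact hL ▸ L.finite_toSet.isCompact_biUnion fun A _ => isCompact_carrier A

theorem carriers_nil : carriers [] = ∅ := by simp [carriers]

theorem carriers_cons (A : List Plane) (L : List (List Plane)) :
    carriers (A :: L) = carrier A ∪ carriers L := by ext; simp [carriers]

/-- The end points of a curve. -/
def ends (A : List Plane) : Set Plane := {x | A.head? = some x ∨ A.getLast? = some x}

theorem head_mem_ends (x : Plane) (l : List Plane) : x ∈ ends (x :: l) := .inl rfl

theorem last_mem_ends (l : List Plane) (x : Plane) : x ∈ ends (l ++ [x]) :=
  .inr List.getLast?_concat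

theorem last_mem_ends_pair (l : List Plane) (x y : Plane) : y ∈ ends (l ++ [x, y]) := by
  simpa using last_mem_ends (l ++ [x]) y

theorem ends_subset_carrier (A : List Plane) : ends A ⊆ carrier A := fun _ hx =>
  hx.elim mem_carrier_of_head? mem_carrier_of_getLast?

theorem eq_or_eq_of_mem_ends {A : List Plane} {u w x : Plane} (hu : u ∈ ends A) (hw : w ∈ ends A)
    (huw : u ≠ w) (hx : x ∈ ends A) : x = u ∨ x = w := by
  rcases hu with hu | hu <;> rcases hw with hw | hw <;> rcases hx with hx | hx <;> simp_all

theorem carrier_stub (s : Tip) : carrier s.stub = segment ℝ s.root s.free :=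
  carrier_pair _ _

namespace Drawing

/-- The points of the vertices and edges of a drawing. -/
def graph (D : Drawing) : Set Plane := {x | x ∈ D.vertices} ∪ carriers D.edges

/-- Two points are ends of the same edge. -/
def Adj (D : Drawing) (u w : Plane) : Prop := ∃ A ∈ D.edges, u ∈ ends A ∧ w ∈ ends A

/-- Two vertices are in the same component of the graph. -/
def Linked (D : Drawing) : Plane → Plane → Prop := Relation.EqvGen D.Adj

/-- The points of the component of the graph that contains the vertex `v`. -/
def component (D : Drawing) (v : Plane) : Set Plane :=
  {x | x ∈ D.vertices ∧ D.Linked v x ∨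
    ∃ A ∈ D.edges, (∃ w ∈ ends A, D.Linked v w) ∧ x ∈ carrier A}

/-- Without leaving `O` and without crossing the graph, one can get from `z` to an open tip of
the component of `v`. -/
def ReachesTip (D : Drawing) (O : Set Plane) (v z : Plane) : Prop :=
  ∃ s ∈ D.tips, D.Linked v s.root ∧ ∃ y ∈ segment ℝ s.root s.free, y ≠ s.root ∧
    PolyJoined (O \ D.graph) z y

/-- Tips are spread along the contours: whoever approaches a component of the graph can reach one
of the open tips of this component, without leaving a given neighbourhood of the component. -/
def TipsReachable (D : Drawing) : Prop :=
  ∀ v ∈ D.vertices, ∀ O : Set Plane, IsOpen O → D.component v ⊆ O → ∀ x ∈ D.component v,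
    ∀ z ∉ D.graph, segment ℝ x z ⊆ O → segment ℝ x z ∩ D.graph ⊆ {x} → D.ReachesTip O v z

variable {D : Drawing} {u v w x : Plane}

theorem isClosed_graph (D : Drawing) : IsClosed D.graph :=
  D.vertices.finite_toSet.isClosed.union (isCompact_carriers _).isClosed

theorem isCompact_component (D : Drawing) (v : Plane) : IsCompact (D.component v) := by
  have hv : D.component v = {x | x ∈ D.vertices ∧ D.Linked v x} ∪
      ⋃ A ∈ {A | A ∈ D.edges ∧ ∃ w ∈ ends A, D.Linked v w}, carrier A := by
    ext; simp only [component, mem_union, mem_ofPred_eq, mem_iUnion, exists_prop, and_assoc]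
  rw [hv]
  exact (D.vertices.finite_toSet.subset fun x hx => hx.1).isCompact.union <|
    (D.edges.finite_toSet.subset fun A hA => hA.1).isCompact_biUnion fun A _ => isCompact_carrier A

theorem component_subset_graph (D : Drawing) (v : Plane) : D.component v ⊆ D.graph := by
  rintro x (⟨hx, -⟩ | ⟨A, hA, -, hx⟩)
  exacts [.inl hx, .inr ⟨A, hA, hx⟩]

theorem Linked.refl (v : Plane) : D.Linked v v := Relation.EqvGen.refl v

theorem Linked.symm (h : D.Linked u v) : D.Linked v u := Relation.EqvGen.symm _ _ h

theorem Linked.trans (h : D.Linked u v) (h' : D.Linked v w) : D.Linked u w :=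
  Relation.EqvGen.trans _ _ _ h h'

theorem Adj.linked (h : D.Adj u v) : D.Linked u v := Relation.EqvGen.rel _ _ h

theorem mem_component_self (hv : v ∈ D.vertices) : v ∈ D.component v := .inl ⟨hv, .refl v⟩

theorem Linked.component_subset (h : D.Linked u v) : D.component v ⊆ D.component u := by
  rintro x (⟨hx, hvx⟩ | ⟨A, hA, ⟨w, hw, hvw⟩, hx⟩)
  exacts [.inl ⟨hx, h.trans hvx⟩, .inr ⟨A, hA, ⟨w, hw, h.trans hvw⟩, hx⟩]

theorem Linked.polyJoined (h : D.Linked u v) : PolyJoined D.graph u v := by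
  induction h with
  | rel u v h =>
    obtain ⟨A, hA, hu, hv⟩ := h
    exact (polyJoined_of_mem_carrier (ends_subset_carrier A hu) (ends_subset_carrier A hv)).mono
      fun x hx => .inr ⟨A, hA, hx⟩
  | refl => exact .refl _
  | symm _ _ _ ih => exact ih.symm
  | trans _ _ _ _ _ ih ih' => exact ih.trans ih'

namespace IsPlane

variable {A B : List Plane} {s t : Tip}

theorem ends_subset (hD : D.IsPlane) (hA : A ∈ D.edges) (hx : x ∈ ends A) : x ∈ D.vertices := by
  obtain ⟨u, hu, w, hw, hAu, hAw, -⟩ := hD.edge_ends A hA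
  rcases hx with hx | hx <;> simp_all

theorem mem_ends (hD : D.IsPlane) (hA : A ∈ D.edges) (hx : x ∈ D.vertices) (hxA : x ∈ carrier A) :
    x ∈ ends A := by
  obtain ⟨u, -, w, -, hAu, hAw, h⟩ := hD.edge_ends A hA
  rcases h x hx hxA with rfl | rfl
  exacts [.inl hAu, .inr hAw]

theorem pairwise_edges (hD : D.IsPlane) :
    D.edges.Pairwise fun A B => ∀ x ∈ carrier A ∩ carrier B, x ∈ D.vertices :=
  (List.pairwise_append.1 hD.noncrossing).1

theorem pairwise_tips (hD : D.IsPlane) : D.tips.Pairwise fun s t =>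
    ∀ x ∈ carrier s.stub ∩ carrier t.stub, x ∈ D.vertices :=
  List.pairwise_map.1 (List.pairwise_append.1 hD.noncrossing).2.1

theorem mem_vertices_of_mem_edges (hD : D.IsPlane) (hA : A ∈ D.edges) (hB : B ∈ D.edges)
    (hAB : A ≠ B) (hx : x ∈ carrier A) (hx' : x ∈ carrier B) : x ∈ D.vertices :=
  have : Std.Symm fun A B : List Plane => ∀ x ∈ carrier A ∩ carrier B, x ∈ D.vertices :=
    ⟨fun _ _ h x hx => h x hx.symm⟩
  hD.pairwise_edges.forall hA hB hAB x ⟨hx, hx'⟩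

theorem root_mem (hD : D.IsPlane) (hs : s ∈ D.tips) : s.root ∈ D.vertices := (hD.tip_ends s hs).1

theorem root_ne_free (hD : D.IsPlane) (hs : s ∈ D.tips) : s.root ≠ s.free :=
  (hD.isArc s.stub (List.mem_append_right _ (List.mem_map_of_mem hs))).2.1

theorem eq_root_of_mem_vertices (hD : D.IsPlane) (hs : s ∈ D.tips) (hx : x ∈ D.vertices)
    (hx' : x ∈ segment ℝ s.root s.free) : x = s.root :=
  (hD.tip_ends s hs).2 x hx (carrier_stub s ▸ hx')

theorem eq_root_of_mem_graph (hD : D.IsPlane) (hs : s ∈ D.tips)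
    (hx : x ∈ segment ℝ s.root s.free) (hxG : x ∈ D.graph) : x = s.root := by
  rcases hxG with hxG | ⟨A, hA, hxA⟩
  · exact hD.eq_root_of_mem_vertices hs hxG hx
  · have hxV := (List.pairwise_append.1 hD.noncrossing).2.2 A hA s.stub (List.mem_map_of_mem hs) x
      ⟨hxA, carrier_stub s ▸ hx⟩
    exact hD.eq_root_of_mem_vertices hs hxV hx

theorem free_notMem_graph (hD : D.IsPlane) (hs : s ∈ D.tips) : s.free ∉ D.graph := fun h =>
  hD.root_ne_free hs (hD.eq_root_of_mem_graph hs (right_mem_segment ℝ _ _) h).symm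

theorem nodup_tips (hD : D.IsPlane) : D.tips.Nodup :=
  hD.pairwise_tips.imp_of_mem fun {s t} hs _ h => by
    rintro rfl
    have hfree := carrier_stub s ▸ right_mem_segment ℝ s.root s.free
    exact hD.free_notMem_graph hs (.inl (h s.free ⟨hfree, hfree⟩))

theorem polyJoined_free (hD : D.IsPlane) (hs : s ∈ D.tips) (hx : x ∈ segment ℝ s.root s.free)
    (hxs : x ≠ s.root) : PolyJoined D.graphᶜ x s.free :=
  .of_segment fun _ hy =>
    have hy := segment_subset_segment_diff_left hx hxs hy
    fun hyG => hy.2 (hD.eq_root_of_mem_graph hs hy.1 hyG)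

theorem linked_of_mem_vertices (hD : D.IsPlane) (hx : x ∈ D.vertices) (hxv : x ∈ D.component v) :
    D.Linked v x := by
  rcases hxv with ⟨-, hvx⟩ | ⟨A, hA, ⟨w, hw, hvw⟩, hxA⟩
  · exact hvx
  · exact hvw.trans (Adj.linked ⟨A, hA, hw, hD.mem_ends hA hx hxA⟩)

theorem linked_of_mem_component (hD : D.IsPlane) (hv : x ∈ D.component v)
    (hw : x ∈ D.component w) : D.Linked v w := by
  by_cases hx : x ∈ D.vertices
  · exact (hD.linked_of_mem_vertices hx hv).trans (hD.linked_of_mem_vertices hx hw).symm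
  obtain ⟨A, hA, ⟨a, ha, hva⟩, hxA⟩ := hv.resolve_left (hx ∘ And.left)
  obtain ⟨B, hB, ⟨b, hb, hwb⟩, hxB⟩ := hw.resolve_left (hx ∘ And.left)
  obtain rfl : A = B := by_contra fun hAB => hx (hD.mem_vertices_of_mem_edges hA hB hAB hxA hxB)
  exact hva.trans ((Adj.linked ⟨A, hA, ha, hb⟩).trans hwb.symm)

theorem exists_mem_component (hD : D.IsPlane) (hx : x ∈ D.graph) :
    ∃ v ∈ D.vertices, x ∈ D.component v := by
  rcases hx with hx | ⟨A, hA, hxA⟩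
  · exact ⟨x, hx, mem_component_self hx⟩
  · obtain ⟨u, hu, -, -, hAu, -⟩ := hD.edge_ends A hA
    exact ⟨u, hu, .inr ⟨A, hA, ⟨u, .inl hAu, .refl u⟩, hxA⟩⟩

end IsPlane

end Drawing

theorem exists_segment_inter_union_subset {E : Type*} [NormedAddCommGroup E] [NormedSpace ℝ E]
    {K L : Set E} (hK : IsCompact K) (hL : IsCompact L) (hK' : K.Nonempty) (hL' : L.Nonempty) :
    ∃ x ∈ K, ∃ y ∈ L, segment ℝ x y ∩ (K ∪ L) ⊆ {x, y} := by
  obtain ⟨⟨x, y⟩, ⟨hx, hy⟩, hmin⟩ := (hK.prod hL).exists_isMinOn (hK'.prod hL')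
    continuous_dist.continuousOn
  refine ⟨x, hx, y, hy, fun z ⟨hz, hzKL⟩ => ?_⟩
  have hsum := dist_add_dist_of_mem_segment hz
  rcases hzKL with hzK | hzL
  · have hzy : dist x y ≤ dist z y := isMinOn_iff.1 hmin (z, y) ⟨hzK, hy⟩
    exact .inl (dist_le_zero.1 (by linarith : dist x z ≤ 0)).symm
  · have hxz : dist x y ≤ dist x z := isMinOn_iff.1 hmin (x, z) ⟨hx, hzL⟩
    exact .inr (dist_le_zero.1 (by linarith : dist z y ≤ 0))

namespace Drawing

variable {D : Drawing}

/-- The graph of the drawing is connected. -/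
def IsConnected (D : Drawing) : Prop := ∀ u ∈ D.vertices, ∀ w ∈ D.vertices, D.Linked u w

/-- The vertices in `H` and the edges in `A` form a tree in the graph of the drawing, and this
tree does not separate the plane. The edges in `B` are the other edges of the drawing. -/
structure IsSubtree (D : Drawing) (H : Finset Plane) (A B : List (List Plane)) : Prop where
  perm : (A ++ B).Perm D.edges
  subset : ∀ v ∈ H, v ∈ D.vertices
  ends_subset : ∀ e ∈ A, ends e ⊆ H
  card_eq : H.card = A.length + 1
  hasFacesLE : HasFacesLE (H ∪ carriers A) 1

theorem noncrossing_of_perm {V : List Plane} {L L' : List (List Plane)} (hL : L.Perm L')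
    (h : L.Pairwise fun A B => ∀ x ∈ carrier A ∩ carrier B, x ∈ V) :
    L'.Pairwise fun A B => ∀ x ∈ carrier A ∩ carrier B, x ∈ V :=
  (hL.pairwise_iff fun h x hx => h x hx.symm).1 h

namespace IsPlane

theorem hasFacesLE_add (hD : D.IsPlane) {A B : List (List Plane)} {N : ℕ}
    (hp : (A ++ B).Perm D.edges) (h : HasFacesLE ({x | x ∈ D.vertices} ∪ carriers A) N) :
    HasFacesLE D.graph (N + B.length) := by
  induction B generalizing A N with
  | nil =>
    have hA : carriers A = carriers D.edges := by
      ext x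
      simp only [carriers, mem_ofPred_eq, (A.append_nil ▸ hp).mem_iff]
    rwa [hA] at h
  | cons e B ih =>
    have hp' : (e :: A ++ B).Perm D.edges := List.perm_middle.symm.trans hp
    have he : e ∈ D.edges := hp'.subset List.mem_cons_self
    obtain ⟨u, hu, w, hw, heu, hew, hends⟩ := hD.edge_ends e he
    rw [List.length_cons, add_comm B.length, ← add_assoc]
    refine ih hp' ?_
    rw [carriers_cons, union_comm (carrier e), ← union_assoc]
    refine h.union_carrier (D.vertices.finite_toSet.isClosed.union (isCompact_carriers A).isClosed)
      (hD.isArc e (List.mem_append_left _ he)) heu hew (.inl hu) (.inl hw) ?_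
    rintro x ⟨hx, hxV | ⟨a, ha, hxa⟩⟩
    · exact hends x hxV hx
    · exact hends x ((List.pairwise_cons.1 (noncrossing_of_perm hp'.symm hD.pairwise_edges)).1 a
        (List.mem_append_left _ ha) x ⟨hx, hxa⟩) hx

end IsPlane

theorem IsConnected.exists_edge (hc : D.IsConnected) {H : Set Plane} {v w : Plane} (hv : v ∈ H)
    (hvV : v ∈ D.vertices) (hw : w ∉ H) (hwV : w ∈ D.vertices) :
    ∃ e ∈ D.edges, (∃ u ∈ ends e, u ∈ H) ∧ ∃ u ∈ ends e, u ∉ H := by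
  by_contra! hcon
  have hH : ∀ {a b}, D.Linked a b → (a ∈ H ↔ b ∈ H) := by
    intro a b hab
    induction hab with
    | rel a b hab =>
      obtain ⟨e, he, ha, hb⟩ := hab
      exact ⟨fun haH => hcon e he ⟨a, ha, haH⟩ b hb, fun hbH => hcon e he ⟨b, hb, hbH⟩ a ha⟩
    | refl => rfl
    | symm _ _ _ ih => exact ih.symm
    | trans _ _ _ _ _ ih ih' => exact ih.trans ih'
  exact hw ((hH (hc v hvV w hwV)).1 hv)

theorem IsSubtree.cons (hD : D.IsPlane) {H : Finset Plane} {A B : List (List Plane)}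
    (h : D.IsSubtree H A B) {e : List Plane} (he : e ∈ D.edges) {u w : Plane} (hu : u ∈ ends e)
    (huH : u ∈ H) (hw : w ∈ ends e) (hwH : w ∉ H) :
    ∃ B', D.IsSubtree (insert w H) (e :: A) B' := by
  have heA : e ∉ A := fun heA => hwH (h.ends_subset e heA hw)
  have heB : e ∈ B := (List.mem_append.1 (h.perm.symm.subset he)).resolve_left heA
  obtain ⟨B₁, B₂, rfl⟩ := List.append_of_mem heB
  have hp : (e :: A ++ (B₁ ++ B₂)).Perm D.edges :=
    (List.perm_middle.symm.trans (List.perm_middle.symm.append_left A)).trans h.perm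
  have hends : ∀ x ∈ ends e, x = u ∨ x = w := fun x =>
    eq_or_eq_of_mem_ends hu hw (ne_of_mem_of_not_mem huH hwH)
  refine ⟨B₁ ++ B₂, hp, ?_, ?_, ?_, ?_⟩
  · exact (Finset.forall_mem_insert _ _ _).2 ⟨hD.ends_subset he hw, h.subset⟩
  · refine List.forall_mem_cons.2 ⟨fun x hx => ?_, fun a ha x hx => ?_⟩
    · rcases hends x hx with rfl | rfl <;> simp [huH]
    · exact Finset.mem_insert_of_mem (h.ends_subset a ha hx)
  · rw [Finset.card_insert_of_notMem hwH, h.card_eq, List.length_cons]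
  · have hset : ((insert w H : Finset Plane) : Set Plane) ∪ carriers (e :: A) =
        (H : Set Plane) ∪ carriers A ∪ carrier e := by
      rw [Finset.coe_insert, carriers_cons, insert_union, union_comm (carrier e), ← union_assoc,
        insert_eq_of_mem (.inr (ends_subset_carrier e hw))]
    rw [hset]
    refine h.hasFacesLE.union_carrier_of_leaf (H.finite_toSet.isClosed.union
      (isCompact_carriers A).isClosed) (hD.isArc e (List.mem_append_left _ he)).2 hu (.inl huH) ?_
    have hH : carrier e ∩ (H ∪ carriers A) ⊆ H := by
      rintro x ⟨hx, hxH | ⟨a, ha, hxa⟩⟩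
      · exact hxH
      · have hxV := (List.pairwise_cons.1 (noncrossing_of_perm hp.symm hD.pairwise_edges)).1 a
          (List.mem_append_left _ ha) x ⟨hx, hxa⟩
        exact h.ends_subset a ha (hD.mem_ends (h.perm.subset (List.mem_append_left _ ha)) hxV hxa)
    exact fun x hx => (hends x (hD.mem_ends he (h.subset x (hH hx)) hx.1)).resolve_right
      fun e => hwH (e ▸ hH hx)

theorem exists_isSubtree (hD : D.IsPlane) (hc : D.IsConnected) {k : ℕ}
    (hk : k < D.vertices.length) : ∃ H A B, D.IsSubtree H A B ∧ A.length = k := by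
  induction k with
  | zero =>
    obtain ⟨v, hv⟩ := List.exists_mem_of_length_pos hk
    refine ⟨{v}, [], D.edges, ⟨.refl _, by simpa using hv, by simp, by simp, ?_⟩, rfl⟩
    rw [carriers_nil, union_empty, Finset.coe_singleton]
    exact .singleton v
  | succ k ih =>
    obtain ⟨H, A, B, h, rfl⟩ := ih (by omega)
    obtain ⟨v, hv⟩ : H.Nonempty := Finset.card_pos.1 (by simp [h.card_eq])
    obtain ⟨w, hw, hwH⟩ := Finset.exists_mem_notMem_of_card_lt_card
      (by rwa [h.card_eq, List.toFinset_card_of_nodup hD.nodup] : H.card < D.vertices.toFinset.card)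
    obtain ⟨e, he, ⟨a, ha, haH⟩, b, hb, hbH⟩ := hc.exists_edge (H := H) hv (h.subset v hv) hwH
      (List.mem_toFinset.1 hw)
    obtain ⟨B', h'⟩ := h.cons hD he ha haH hb hbH
    exact ⟨_, _, _, h', rfl⟩

-- Half of Euler's formula: outside a spanning tree, every edge adds at most one face.
theorem IsPlane.hasFacesLE_of_isConnected (hD : D.IsPlane) (hne : D.vertices ≠ [])
    (hc : D.IsConnected) :
    ∃ N, HasFacesLE D.graph N ∧ N + D.vertices.length = D.edges.length + 2 := by
  have hpos := List.length_pos_iff.2 hne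
  obtain ⟨H, A, B, h, hA⟩ := exists_isSubtree hD hc (Nat.sub_lt hpos one_pos)
  have hH : (H : Set Plane) = {x | x ∈ D.vertices} := by
    rw [← List.coe_toFinset, Finset.coe_inj]
    refine Finset.eq_of_subset_of_card_le (fun v hv => List.mem_toFinset.2 (h.subset v hv)) ?_
    rw [List.toFinset_card_of_nodup hD.nodup, h.card_eq]
    omega
  refine ⟨_, hD.hasFacesLE_add h.perm (hH ▸ h.hasFacesLE), ?_⟩
  have := h.perm.length_eq
  rw [List.length_append] at this
  omega

/-- Different open tips lie in different faces. -/
def TipsSeparated (D : Drawing) : Prop :=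
  ∀ s ∈ D.tips, ∀ t ∈ D.tips, PolyJoined D.graphᶜ s.free t.free → s = t

theorem TipsSeparated.length_tips_le (h : D.TipsSeparated) (hD : D.IsPlane) {N : ℕ}
    (hN : HasFacesLE D.graph N) : D.tips.length ≤ N := by
  classical
  have hinj : InjOn Tip.free (D.tips.toFinset : Set Tip) := fun s hs t ht hst =>
    h s (by simpa using hs) t (by simpa using ht) (hst ▸ .refl _)
  rw [← List.toFinset_card_of_nodup hD.nodup_tips, ← Finset.card_image_of_injOn hinj]
  refine hN _ ?_ ?_
  · simp only [Finset.forall_mem_image, List.mem_toFinset]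
    exact fun s => hD.free_notMem_graph
  · simp only [Set.Pairwise, Finset.coe_image, forall_mem_image, List.coe_toFinset]
    exact fun s hs t ht hst hj => hst (h s hs t ht hj ▸ rfl)

theorem TipsReachable.exists_polyJoined_free (hr : D.TipsReachable) (hD : D.IsPlane)
    {v x z : Plane} (hv : v ∈ D.vertices) (hx : x ∈ D.component v) (hz : z ∉ D.graph)
    (hxz : segment ℝ x z ∩ D.graph ⊆ {x}) :
    ∃ s ∈ D.tips, D.Linked v s.root ∧ PolyJoined D.graphᶜ z s.free := by
  obtain ⟨s, hs, hvs, y, hy, hys, hzy⟩ := hr v hv univ isOpen_univ (subset_univ _) x hx z hz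
    (subset_univ _) hxz
  exact ⟨s, hs, hvs, (hzy.mono (sdiff_subset_compl _ _)).trans (hD.polyJoined_free hs hy hys)⟩

theorem exists_segment_between_components (hD : D.IsPlane) {u w : Plane} (hu : u ∈ D.vertices)
    (hw : w ∈ D.vertices) (huw : ¬ D.Linked u w) :
    ∃ x ∈ D.component u, ∃ v ∈ D.vertices, ¬ D.Linked u v ∧ ∃ y ∈ D.component v,
      segment ℝ x y ∩ D.graph ⊆ {x, y} := by
  have hV : {v | v ∈ D.vertices ∧ ¬ D.Linked u v}.Finite :=
    D.vertices.finite_toSet.subset fun v hv => hv.1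
  obtain ⟨x, hx, y, hy, hxy⟩ := exists_segment_inter_union_subset (D.isCompact_component u)
    (hV.isCompact_biUnion fun v _ => D.isCompact_component v) ⟨u, mem_component_self hu⟩
    ⟨w, mem_biUnion (show w ∈ {v | v ∈ D.vertices ∧ ¬ D.Linked u v} from ⟨hw, huw⟩)
      (mem_component_self hw)⟩
  obtain ⟨v, ⟨hv, huv⟩, hyv⟩ := mem_iUnion₂.1 hy
  refine ⟨x, hx, v, hv, huv, y, hyv, fun z hz => hxy ⟨hz.1, ?_⟩⟩
  obtain ⟨a, ha, hza⟩ := hD.exists_mem_component hz.2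
  by_cases hua : D.Linked u a
  · exact .inl (hua.component_subset hza)
  · exact .inr (mem_biUnion (show a ∈ {v | v ∈ D.vertices ∧ ¬ D.Linked u v} from ⟨ha, hua⟩) hza)

-- A shortest segment between two components would join a tip of one to a tip of the other.
theorem TipsSeparated.isConnected (h : D.TipsSeparated) (hD : D.IsPlane) (hr : D.TipsReachable) :
    D.IsConnected := by
  by_contra! hcon
  simp only [IsConnected, not_forall] at hcon
  obtain ⟨u, hu, w, hw, huw⟩ := hcon
  obtain ⟨x, hx, v, hv, huv, y, hy, hxy⟩ := exists_segment_between_components hD hu hw huw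
  have hne : x ≠ y := fun e => huv (hD.linked_of_mem_component hx (e ▸ hy))
  have hz : midpoint ℝ x y ∈ segment ℝ x y := midpoint_mem_segment x y
  have hzx : midpoint ℝ x y ≠ x := by simpa using hne
  have hzy : midpoint ℝ x y ≠ y := by simpa using hne
  have hzG : midpoint ℝ x y ∉ D.graph := fun hzG => (hxy ⟨hz, hzG⟩).elim hzx hzy
  obtain ⟨s, hs, hus, hzs⟩ := hr.exists_polyJoined_free hD hu hx hzG fun a ⟨ha, haG⟩ => by
    rw [segment_symm] at ha
    have ha := segment_subset_segment_diff_left (segment_symm ℝ x y ▸ hz) hzy ha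
    exact (hxy ⟨segment_symm ℝ y x ▸ ha.1, haG⟩).resolve_right ha.2
  obtain ⟨t, ht, hvt, hzt⟩ := hr.exists_polyJoined_free hD hv hy hzG fun a ⟨ha, haG⟩ => by
    rw [segment_symm] at ha
    have ha := segment_subset_segment_diff_left hz hzx ha
    exact (hxy ⟨ha.1, haG⟩).resolve_left ha.2
  exact huv (hus.trans (h s hs t ht (hzs.symm.trans hzt) ▸ hvt.symm))

end Drawing

/-- The number of classes of an equivalence relation that meet a set. -/
noncomputable def numClasses {α : Type*} (r : Setoid α) (A : Set α) : ℕ :=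
  (Quotient.mk r '' A).ncard

section numClasses

variable {α : Type*} {r r' : Setoid α} {A A' : Set α}

theorem numClasses_le_length (r : Setoid α) (l : List α) : numClasses r {a | a ∈ l} ≤ l.length := by
  classical
  refine (ncard_image_le l.finite_toSet).trans ?_
  rw [← List.coe_toFinset, ncard_coe_finset]
  exact l.toFinset_card_le

theorem numClasses_pos (r : Setoid α) (hA : A.Finite) (hne : A.Nonempty) : 0 < numClasses r A :=
  (ncard_pos (hA.image _)).2 (hne.image _)

theorem image_mk_subset_image_map (hr : r ≤ r') (hA : ∀ a ∈ A, ∃ b ∈ A', r' a b) :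
    Quotient.mk r' '' A ⊆ Quotient.map' (s₁ := r) (s₂ := r') id hr '' (Quotient.mk r '' A') := by
  rintro _ ⟨a, ha, rfl⟩
  obtain ⟨b, hb, hab⟩ := hA a ha
  exact ⟨_, ⟨b, hb, rfl⟩, (Quotient.sound hab).symm⟩

theorem numClasses_le (hr : r ≤ r') (hA' : A'.Finite) (hA : ∀ a ∈ A, ∃ b ∈ A', r' a b) :
    numClasses r' A ≤ numClasses r A' :=
  (ncard_le_ncard (image_mk_subset_image_map hr hA) ((hA'.image _).image _)).trans
    (ncard_image_le (hA'.image _))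

theorem numClasses_lt (hr : r ≤ r') (hA' : A'.Finite) (hA : ∀ a ∈ A, ∃ b ∈ A', r' a b) {c d : α}
    (hc : c ∈ A') (hd : d ∈ A') (hcd : r' c d) (hcd' : ¬ r c d) :
    numClasses r' A < numClasses r A' := by
  have hfin := hA'.image (Quotient.mk r)
  have hmap : Quotient.mk r' '' A ⊆ Quotient.map' (s₁ := r) (s₂ := r') id hr ''
      (Quotient.mk r '' A' \ {Quotient.mk r d}) := by
    intro x hx
    obtain ⟨y, hy, rfl⟩ := image_mk_subset_image_map hr hA hx
    rcases eq_or_ne y (Quotient.mk r d) with rfl | hyd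
    · exact ⟨_, ⟨⟨c, hc, rfl⟩, fun h => hcd' (Quotient.exact h)⟩, Quotient.sound hcd⟩
    · exact ⟨y, ⟨hy, hyd⟩, rfl⟩
  calc numClasses r' A ≤ (Quotient.mk r '' A' \ {Quotient.mk r d}).ncard :=
        (ncard_le_ncard hmap (hfin.sdiff.image _)).trans (ncard_image_le hfin.sdiff)
    _ < numClasses r A' := ncard_sdiff_singleton_lt_of_mem ⟨d, hd, rfl⟩ hfin

end numClasses

namespace Drawing

/-- Being in the same face of the graph of a drawing. -/
def faceSetoid (D : Drawing) : Setoid Plane := ⟨PolyJoined D.graphᶜ, .refl, .symm, .trans⟩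

/-- Being in the same component of the graph of a drawing. -/
def linkedSetoid (D : Drawing) : Setoid Plane := ⟨D.Linked, .refl, .symm, .trans⟩

/-- The number of faces that contain free ends of open tips. -/
noncomputable def numFaces (D : Drawing) : ℕ :=
  numClasses D.faceSetoid {x | x ∈ D.tips.map Tip.free}

/-- The number of components of the graph. -/
noncomputable def numComponents (D : Drawing) : ℕ :=
  numClasses D.linkedSetoid {v | v ∈ D.vertices}

theorem numFaces_le (D : Drawing) : D.numFaces ≤ D.tips.length :=
  (numClasses_le_length _ _).trans_eq (List.length_map _)

theorem numComponents_le (D : Drawing) : D.numComponents ≤ D.vertices.length :=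
  numClasses_le_length _ _

theorem numFaces_pos {D : Drawing} (h : D.tips ≠ []) : 0 < D.numFaces :=
  numClasses_pos _ (List.finite_toSet _) (List.exists_mem_of_ne_nil _ (by simpa using h))

theorem numComponents_pos {D : Drawing} (h : D.vertices ≠ []) : 0 < D.numComponents :=
  numClasses_pos _ D.vertices.finite_toSet (List.exists_mem_of_ne_nil _ h)

end Drawing

/-- The move from `D` to `D'` that joins the tips `s` and `t` by the curve `l₁, p, q, l₂` and
draws the crossbar from `c` to `d` through `m`; the fields are the clauses of `IsMove`. -/
structure MoveData (D D' : Drawing) (s t : Tip) (rest : List Tip) (l₁ l₂ : List Plane)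
    (p q m c d : Plane) : Prop where
  perm : D.tips.Perm (s :: t :: rest)
  head : (l₁ ++ p :: q :: l₂).head? = some s.free
  last : (l₁ ++ p :: q :: l₂).getLast? = some t.free
  mem_openSegment : m ∈ openSegment ℝ p q
  mem_crossbar : m ∈ openSegment ℝ c d
  vertices : D'.vertices = m :: D.vertices
  edges : D'.edges = (s.root :: (l₁ ++ [p, m])) :: (m :: q :: (l₂ ++ [t.root])) :: D.edges
  tips : D'.tips = Tip.mk m c :: Tip.mk m d :: rest
  isPlane : D'.IsPlane

theorem IsMove.exists_moveData {D D' : Drawing} (h : IsMove D D') :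
    ∃ s t rest l₁ l₂ p q m c d, MoveData D D' s t rest l₁ l₂ p q m c d := by
  obtain ⟨s, t, rest, l₁, l₂, p, q, m, c, d, h1, h2, h3, h4, h5, h6, h7, h8, h9⟩ := h
  exact ⟨s, t, rest, l₁, l₂, p, q, m, c, d, h1, h2, h3, h4, h5, h6, h7, h8, h9⟩

namespace MoveData

variable {D D' : Drawing} {s t u : Tip} {rest : List Tip} {l₁ l₂ A : List Plane}
  {p q m c d v v' w x z g : Plane} {O : Set Plane} (h : MoveData D D' s t rest l₁ l₂ p q m c d)

/-- The points of the two edges that a move adds to the graph. -/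
def curve (_ : MoveData D D' s t rest l₁ l₂ p q m c d) : Set Plane :=
  Chord.points (s.root :: l₁) (l₂ ++ [t.root]) p q m

include h

theorem left_mem : s ∈ D.tips := h.perm.symm.subset List.mem_cons_self

theorem right_mem : t ∈ D.tips :=
  h.perm.symm.subset (List.mem_cons_of_mem _ List.mem_cons_self)

theorem left_edge_mem : s.root :: l₁ ++ [p, m] ∈ D'.edges :=
  h.edges ▸ List.mem_cons_self

theorem right_edge_mem : m :: q :: (l₂ ++ [t.root]) ∈ D'.edges :=
  h.edges ▸ List.mem_cons_of_mem _ List.mem_cons_self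

theorem edge_mem (hA : A ∈ D.edges) : A ∈ D'.edges :=
  h.edges ▸ List.mem_cons_of_mem _ (List.mem_cons_of_mem _ hA)

theorem mem_vertices : m ∈ D'.vertices := h.vertices ▸ List.mem_cons_self

theorem vertex_mem (hv : v ∈ D.vertices) : v ∈ D'.vertices :=
  h.vertices ▸ List.mem_cons_of_mem _ hv

theorem left_tip_mem : Tip.mk m c ∈ D'.tips := h.tips ▸ List.mem_cons_self

theorem right_tip_mem : Tip.mk m d ∈ D'.tips :=
  h.tips ▸ List.mem_cons_of_mem _ List.mem_cons_self

theorem tip_mem (hu : u ∈ D.tips) (hus : u ≠ s) (hut : u ≠ t) : u ∈ D'.tips := by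
  have hu' := h.perm.subset hu
  simp only [List.mem_cons, hus, hut, false_or] at hu'
  exact h.tips ▸ List.mem_cons_of_mem _ (List.mem_cons_of_mem _ hu')

theorem notMem_vertices : m ∉ D.vertices :=
  (List.nodup_cons.1 (h.vertices ▸ h.isPlane.nodup)).1

theorem notMem_carrier (hD : D.IsPlane) (hA : A ∈ D.edges) : m ∉ carrier A := fun hm =>
  h.notMem_vertices (hD.ends_subset hA (h.isPlane.mem_ends (h.edge_mem hA) h.mem_vertices hm))

theorem notMem_graph (hD : D.IsPlane) : m ∉ D.graph := by
  rintro (hm | ⟨A, hA, hm⟩)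
  exacts [h.notMem_vertices hm, h.notMem_carrier hD hA hm]

theorem graph_eq : D'.graph = D.graph ∪ h.curve := by
  have hm : m ∈ h.curve := Chord.mem_points _ _ _ _ _
  ext x
  simp only [Drawing.graph, curve, h.vertices, h.edges, carriers_cons, Chord.points, mem_union,
    mem_ofPred_eq, List.mem_cons, List.cons_append] at hm ⊢
  constructor
  · rintro ((rfl | h) | h | h | h) <;> tauto
  · tauto

theorem graph_subset : D.graph ⊆ D'.graph := h.graph_eq ▸ subset_union_left

theorem curve_subset : h.curve ⊆ D'.graph := h.graph_eq ▸ subset_union_right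

theorem mem_ends_of_mem_graph (hD : D.IsPlane) (hA : A ∈ D'.edges) (hm : m ∈ carrier A)
    (hxA : x ∈ carrier A) (hx : x ∈ D.graph) : x ∈ ends A := by
  refine h.isPlane.mem_ends hA ?_ hxA
  rcases hx with hx | ⟨B, hB, hxB⟩
  · exact h.vertex_mem hx
  · have hAB : A ≠ B := by
      rintro rfl
      exact h.notMem_carrier hD hB hm
    exact h.isPlane.mem_vertices_of_mem_edges hA (h.edge_mem hB) hAB hxA hxB

theorem eq_of_mem_crossbar (hx : x ∈ segment ℝ c d) (hxG : x ∈ D'.graph) : x = m := by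
  rw [← segment_union_segment (openSegment_subset_segment ℝ _ _ h.mem_crossbar),
    segment_symm ℝ c m] at hx
  rcases hx with hx | hx
  exacts [h.isPlane.eq_root_of_mem_graph h.left_tip_mem hx hxG,
    h.isPlane.eq_root_of_mem_graph h.right_tip_mem hx hxG]

theorem left_edge_ne_right_edge (hD : D.IsPlane) :
    s.root :: l₁ ++ [p, m] ≠ m :: q :: (l₂ ++ [t.root]) := fun heq =>
  h.notMem_vertices ((List.cons.inj heq).1 ▸ hD.root_mem h.left_mem)

theorem chord (hD : D.IsPlane) :
    Chord D.graph (s.root :: l₁) (l₂ ++ [t.root]) s.root t.root p q m c d := by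
  have hD' := h.isPlane
  have hs : s.root ≠ m := fun hs => h.notMem_vertices (hs ▸ hD.root_mem h.left_mem)
  have ht : t.root ≠ m := fun ht => h.notMem_vertices (ht ▸ hD.root_mem h.right_mem)
  have hml := last_mem_ends_pair (s.root :: l₁) p m
  have hmr := head_mem_ends m (q :: (l₂ ++ [t.root]))
  have hl {x} := eq_or_eq_of_mem_ends (x := x) (head_mem_ends s.root (l₁ ++ [p, m])) hml hs
  have hr {x} := eq_or_eq_of_mem_ends (x := x) (last_mem_ends (m :: q :: l₂) t.root) hmr ht
  exact
  { isClosed := D.isClosed_graph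
    left_mem := .inl (hD.root_mem h.left_mem)
    right_mem := .inl (hD.root_mem h.right_mem)
    head_eq := rfl
    last_eq := List.getLast?_concat
    isSimple_left := (hD'.isArc _ (List.mem_append_left _ h.left_edge_mem)).2
    isSimple_right := (hD'.isArc _ (List.mem_append_left _ h.right_edge_mem)).2
    mem_openSegment := h.mem_openSegment
    mem_crossbar := h.mem_crossbar
    left_inter := fun x ⟨hx, hxG⟩ =>
      (hl (h.mem_ends_of_mem_graph hD h.left_edge_mem (ends_subset_carrier _ hml) hx
        hxG)).resolve_right (ne_of_mem_of_not_mem hxG (h.notMem_graph hD))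
    right_inter := fun x ⟨hx, hxG⟩ =>
      (hr (h.mem_ends_of_mem_graph hD h.right_edge_mem (ends_subset_carrier _ hmr) hx
        hxG)).resolve_right (ne_of_mem_of_not_mem hxG (h.notMem_graph hD))
    left_inter_right := fun x hx hx' => by
      have hxV := hD'.mem_vertices_of_mem_edges h.left_edge_mem h.right_edge_mem
        (h.left_edge_ne_right_edge hD) hx hx'
      have hxl := hl (hD'.mem_ends h.left_edge_mem hxV hx)
      have hxr := hr (hD'.mem_ends h.right_edge_mem hxV hx')
      tauto
    notMem := h.notMem_graph hD
    ne := by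
      rintro rfl
      have hm : m = c := by simpa using h.mem_crossbar
      exact hD'.root_ne_free h.left_tip_mem hm
    crossbar_inter := fun x ⟨hx, hx'⟩ => h.eq_of_mem_crossbar hx (h.curve_subset hx') }

theorem segment_left_subset_curve : segment ℝ s.root s.free ⊆ h.curve := by
  obtain ⟨l, hl⟩ : ∃ l, l₁ ++ [p] = s.free :: l :=
    List.head?_eq_some_iff.1 (by simpa using h.head)
  have hA : s.root :: l₁ ++ [p, m] = s.root :: s.free :: (l ++ [m]) := by
    rw [List.append_cons, List.cons_append, hl]; rfl
  exact fun x hx => .inl (hA ▸ .inl hx)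

theorem segment_right_subset_curve : segment ℝ t.root t.free ⊆ h.curve := by
  obtain ⟨l, hl⟩ : ∃ l, q :: l₂ = l ++ [t.free] := by
    refine List.getLast?_eq_some_iff.1 ?_
    simpa [List.getLast?_append] using h.last
  have hB : m :: q :: (l₂ ++ [t.root]) = (m :: l) ++ t.free :: [t.root] := by
    rw [← List.cons_append, hl]; simp
  intro x hx
  refine .inr ?_
  rw [hB, carrier_append, carrier_pair, segment_symm]
  exact .inr hx

theorem linked_mono (huw : D.Linked v w) : D'.Linked v w :=
  Relation.EqvGen.mono (fun _ _ hA => hA.imp fun _ hA => ⟨h.edge_mem hA.1, hA.2⟩) v w huw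

theorem linked_left : D'.Linked m s.root :=
  Drawing.Adj.linked ⟨_, h.left_edge_mem, last_mem_ends_pair _ _ _, head_mem_ends _ _⟩

theorem linked_right : D'.Linked m t.root :=
  Drawing.Adj.linked ⟨_, h.right_edge_mem, head_mem_ends _ _, last_mem_ends (m :: q :: l₂) _⟩

theorem component_subset (v : Plane) : D.component v ⊆ D'.component v := by
  rintro x (⟨hx, hvx⟩ | ⟨A, hA, ⟨w, hw, hvw⟩, hx⟩)
  exacts [.inl ⟨h.vertex_mem hx, h.linked_mono hvx⟩,
    .inr ⟨A, h.edge_mem hA, ⟨w, hw, h.linked_mono hvw⟩, hx⟩]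

theorem curve_subset_component : h.curve ⊆ D'.component m := by
  rintro x (hx | hx)
  exacts [.inr ⟨_, h.left_edge_mem, ⟨m, last_mem_ends_pair _ _ _, .refl m⟩, hx⟩,
    .inr ⟨_, h.right_edge_mem, ⟨m, head_mem_ends _ _, .refl m⟩, hx⟩]

theorem exists_vertex_linked (hD : D.IsPlane) (hv : v ∈ D'.vertices) :
    ∃ w ∈ D.vertices, D'.Linked v w := by
  rw [h.vertices, List.mem_cons] at hv
  rcases hv with rfl | hv
  exacts [⟨s.root, hD.root_mem h.left_mem, h.linked_left⟩, ⟨v, hv, .refl v⟩]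

theorem numComponents_le (hD : D.IsPlane) : D'.numComponents ≤ D.numComponents :=
  numClasses_le (r := D.linkedSetoid) (r' := D'.linkedSetoid) (fun _ _ => h.linked_mono)
    (List.finite_toSet _) fun _ => h.exists_vertex_linked hD

theorem numComponents_lt (hD : D.IsPlane) (hst : ¬ D.Linked s.root t.root) :
    D'.numComponents < D.numComponents :=
  numClasses_lt (r := D.linkedSetoid) (r' := D'.linkedSetoid) (fun _ _ => h.linked_mono)
    (List.finite_toSet _) (fun _ => h.exists_vertex_linked hD) (hD.root_mem h.left_mem)
    (hD.root_mem h.right_mem) (h.linked_left.symm.trans h.linked_right) hst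

theorem disjoint_crossbar (hD : D.IsPlane) : Disjoint (segment ℝ c d) D.graph :=
  disjoint_left.2 fun _ hx hxG =>
    h.notMem_graph hD (h.eq_of_mem_crossbar hx (h.graph_subset hxG) ▸ hxG)

theorem polyJoined_of_mem_crossbar (hD : D.IsPlane) (hx : x ∈ segment ℝ c d)
    (hz : z ∈ segment ℝ c d) : PolyJoined D.graphᶜ x z :=
  .of_convex (convex_segment c d) (h.disjoint_crossbar hD).subset_compl_right hx hz

theorem polyJoined_curve (hD : D.IsPlane) (hg : g ∈ h.curve) (hgD : g ∉ D.graph) :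
    PolyJoined D.graphᶜ g c :=
  (((h.chord hD).polyJoined_cross hg hgD).mono (sdiff_subset_compl _ _)).trans
    (h.polyJoined_of_mem_crossbar hD (openSegment_subset_segment ℝ _ _ h.mem_crossbar)
      (left_mem_segment ℝ c d))

theorem exists_free_polyJoined (hD : D.IsPlane) (hx : x ∈ D.tips.map Tip.free) :
    ∃ y ∈ D'.tips.map Tip.free, PolyJoined D.graphᶜ x y := by
  obtain ⟨u, hu, rfl⟩ := List.mem_map.1 hx
  have hfree := right_mem_segment ℝ u.root u.free
  have hc := List.mem_map_of_mem (f := Tip.free) h.left_tip_mem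
  by_cases hus : u = s
  · exact ⟨c, hc, h.polyJoined_curve hD (h.segment_left_subset_curve (hus ▸ hfree))
      (hD.free_notMem_graph hu)⟩
  by_cases hut : u = t
  · exact ⟨c, hc, h.polyJoined_curve hD (h.segment_right_subset_curve (hut ▸ hfree))
      (hD.free_notMem_graph hu)⟩
  exact ⟨u.free, List.mem_map_of_mem (h.tip_mem hu hus hut), .refl _⟩

theorem faceSetoid_le : D'.faceSetoid ≤ D.faceSetoid := fun _ _ hab =>
  PolyJoined.mono (compl_subset_compl.2 h.graph_subset) hab

theorem numFaces_le (hD : D.IsPlane) : D.numFaces ≤ D'.numFaces :=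
  numClasses_le h.faceSetoid_le (List.finite_toSet _) fun _ => h.exists_free_polyJoined hD

theorem numFaces_lt (hD : D.IsPlane) (hst : D.Linked s.root t.root) :
    D.numFaces < D'.numFaces := by
  have hcd : ¬ PolyJoined D'.graphᶜ c d :=
    h.graph_eq ▸ (h.chord hD).not_polyJoined hst.polyJoined (h.disjoint_crossbar hD)
  exact numClasses_lt h.faceSetoid_le (List.finite_toSet _)
    (fun _ => h.exists_free_polyJoined hD) (List.mem_map_of_mem h.left_tip_mem)
    (List.mem_map_of_mem h.right_tip_mem) (h.polyJoined_of_mem_crossbar hD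
      (left_mem_segment ℝ c d) (right_mem_segment ℝ c d)) hcd

/-- A move either merges two components or divides a face. -/
theorem numFaces_add_numComponents_lt (hD : D.IsPlane) :
    D.numFaces + D'.numComponents < D'.numFaces + D.numComponents := by
  by_cases hst : D.Linked s.root t.root
  · exact add_lt_add_of_lt_of_le (h.numFaces_lt hD hst) (h.numComponents_le hD)
  · exact add_lt_add_of_le_of_lt (h.numFaces_le hD) (h.numComponents_lt hD hst)

theorem reachesTip_of_polyJoined_curve (hD : D.IsPlane) (hO : IsOpen O) (hvO : D'.component v ⊆ O)
    (hvm : D'.Linked v m) (hz : z ∈ O \ D'.graph) (hg : g ∈ h.curve) (hgD : g ∉ D.graph)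
    (hzg : PolyJoined (O \ D.graph) z g) : D'.ReachesTip O v z := by
  have hsub : h.curve ⊆ O := h.curve_subset_component.trans (hvm.component_subset.trans hvO)
  have hset (S : Set Plane) : (S ∪ Oᶜ)ᶜ = O \ S := by
    rw [compl_union, compl_compl, inter_comm, sdiff_eq]
  have hset' : (D.graph ∪ Oᶜ ∪ h.curve)ᶜ = O \ D'.graph := by
    rw [union_right_comm, ← h.graph_eq, hset]
  obtain ⟨c', ⟨hc, hcm⟩, d', ⟨hd, hdm⟩, hjoin⟩ :=
    ((h.chord hD).union_compl hO hsub).exists_polyJoined_crossbar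
  have hz' : z ∈ (D.graph ∪ Oᶜ ∪ h.curve)ᶜ := hset'.symm ▸ hz
  rcases hjoin z hz' g ⟨hg, fun hg' => hg'.elim hgD (not_not.2 (hsub hg))⟩
    (hset _ ▸ hzg) with hj | hj
  · exact ⟨_, h.left_tip_mem, hvm, c', hc, hcm, hset' ▸ hj⟩
  · exact ⟨_, h.right_tip_mem, hvm, d', hd, hdm, hset' ▸ hj⟩

theorem reachesTip_of_linked (hD : D.IsPlane) (hO : IsOpen O) (hvO : D'.component v ⊆ O)
    (hvm : D'.Linked v m) (hvv' : D'.Linked v v') (hz : z ∈ O \ D'.graph)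
    (hr : D.ReachesTip O v' z) : D'.ReachesTip O v z := by
  obtain ⟨u, hu, hv'u, y, hy, hyu, hzy⟩ := hr
  have hyD : y ∉ D.graph := fun hyD => hyu (hD.eq_root_of_mem_graph hu hy hyD)
  rcases hzy.diff_or_exists_mem h.curve with hzy' | ⟨g, hg, hgD, hzg⟩
  · by_cases hus : u = s
    · exact h.reachesTip_of_polyJoined_curve hD hO hvO hvm hz
        (h.segment_left_subset_curve (hus ▸ hy)) hyD hzy
    by_cases hut : u = t
    · exact h.reachesTip_of_polyJoined_curve hD hO hvO hvm hz
        (h.segment_right_subset_curve (hut ▸ hy)) hyD hzy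
    refine ⟨u, h.tip_mem hu hus hut, hvv'.trans (h.linked_mono hv'u), y, hy, hyu, ?_⟩
    rwa [h.graph_eq, ← Set.sdiff_sdiff]
  · exact h.reachesTip_of_polyJoined_curve hD hO hvO hvm hz hg hgD.2 hzg

theorem reachesTip_of_not_linked (hvm : ¬ D'.Linked v m) (hvv' : D'.Linked v v')
    (hr : D.ReachesTip (O \ h.curve) v' z) : D'.ReachesTip O v z := by
  obtain ⟨u, hu, hv'u, y, hy, hyu, hzy⟩ := hr
  have hvu := hvv'.trans (h.linked_mono hv'u)
  have hus : u ≠ s := fun hus => hvm (hvu.trans (hus ▸ h.linked_left.symm))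
  have hut : u ≠ t := fun hut => hvm (hvu.trans (hut ▸ h.linked_right.symm))
  refine ⟨u, h.tip_mem hu hus hut, hvu, y, hy, hyu, ?_⟩
  rwa [h.graph_eq, union_comm, ← Set.sdiff_sdiff]

theorem disjoint_component_curve (hvm : ¬ D'.Linked v m) : Disjoint (D'.component v) h.curve :=
  disjoint_left.2 fun _ hx hx' =>
    hvm (h.isPlane.linked_of_mem_component hx (h.curve_subset_component hx'))

theorem reachesTip_of_mem_graph (hD : D.IsPlane) (hr : D.TipsReachable) (hO : IsOpen O)
    (hvO : D'.component v ⊆ O) (hx : x ∈ D'.component v) (hxD : x ∈ D.graph) (hz : z ∉ D'.graph)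
    (hxz : segment ℝ x z ⊆ O) (hxzG : segment ℝ x z ∩ D'.graph ⊆ {x}) : D'.ReachesTip O v z := by
  obtain ⟨v', hv', hxv'⟩ := hD.exists_mem_component hxD
  have hvv' : D'.Linked v v' := h.isPlane.linked_of_mem_component hx (h.component_subset v' hxv')
  have hv'v : D.component v' ⊆ D'.component v := (h.component_subset v').trans hvv'.component_subset
  have hzD : z ∉ D.graph := notMem_subset h.graph_subset hz
  have hxzD : segment ℝ x z ∩ D.graph ⊆ {x} :=
    (inter_subset_inter_right _ h.graph_subset).trans hxzG
  by_cases hvm : D'.Linked v m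
  · exact h.reachesTip_of_linked hD hO hvO hvm hvv' ⟨hxz (right_mem_segment ℝ x z), hz⟩
      (hr v' hv' O hO (hv'v.trans hvO) x hxv' z hzD hxz hxzD)
  · have hdisj := h.disjoint_component_curve hvm
    have hxzC : segment ℝ x z ⊆ O \ h.curve := fun y hy => ⟨hxz hy, fun hyC =>
      disjoint_left.1 hdisj hx (hxzG ⟨hy, h.curve_subset hyC⟩ ▸ hyC)⟩
    exact h.reachesTip_of_not_linked hvm hvv' (hr v' hv' _
      (hO.sdiff (Chord.isClosed_points _ _ _ _ _))
      (subset_sdiff.2 ⟨hv'v.trans hvO, hdisj.mono_left hv'v⟩) x hxv' z hzD hxzC hxzD)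

theorem tipsReachable (hD : D.IsPlane) (hr : D.TipsReachable) : D'.TipsReachable := by
  intro v _ O hO hvO x hx z hz hxz hxzG
  by_cases hxD : x ∈ D.graph
  · exact h.reachesTip_of_mem_graph hD hr hO hvO hx hxD hz hxz hxzG
  have hxC : x ∈ h.curve :=
    (h.graph_eq ▸ D'.component_subset_graph v hx).resolve_left hxD
  have hzx : segment ℝ z x ⊆ O \ D.graph := by
    rw [segment_symm]
    exact fun y hy => ⟨hxz hy, fun hyD => hxD (hxzG ⟨hy, h.graph_subset hyD⟩ ▸ hyD)⟩
  exact h.reachesTip_of_polyJoined_curve hD hO hvO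
    (h.isPlane.linked_of_mem_component hx (h.curve_subset_component hxC))
    ⟨hxz (right_mem_segment ℝ x z), hz⟩ hxC hxD (.of_segment hzx)

end MoveData

section Plane

variable {a c d m p q x : Plane} {Z : Set Plane} {l : List Plane}

theorem segment_inter_segment_subset (hm : m ∈ segment ℝ p q) :
    segment ℝ p m ∩ segment ℝ m q ⊆ {m} := by
  rintro x ⟨hpx, hxq⟩
  have hx := mem_segment_iff_wbtw.1 hxq
  exact (((mem_segment_iff_wbtw.1 hm).trans_right_left hx).swap_right_iff.1
    (mem_segment_iff_wbtw.1 hpx)).symm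

theorem exists_prolongation_segment (hZ : IsClosed Z) (hx : x ∉ Z) (hax : a ≠ x) :
    ∃ e ∉ Z ∪ segment ℝ a x, segment ℝ x e ∩ (Z ∪ segment ℝ a x) ⊆ {x} := by
  obtain ⟨r, hr, hball⟩ := Metric.isOpen_iff.1 hZ.isOpen_compl x hx
  obtain ⟨t, hxt, ht⟩ := ((eventually_add_smul_mem (Metric.ball_mem_nhds x hr)
    (x - a)).filter_mono nhdsWithin_le_nhds).and
    (self_mem_nhdsWithin (a := (0 : ℝ)) (s := Ioi 0)) |>.exists
  have hxe : x ≠ x + t • (x - a) := by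
    rw [ne_eq, left_eq_add, smul_eq_zero, sub_eq_zero]
    exact not_or.2 ⟨ne_of_gt ht, hax.symm⟩
  have hmem : x ∈ segment ℝ a (x + t • (x - a)) := by
    rw [mem_segment_iff_wbtw, wbtw_iff_sameRay_vsub, vsub_eq_sub, vsub_eq_sub, add_sub_cancel_left]
    exact SameRay.sameRay_nonneg_smul_right _ (le_of_lt ht)
  have hinter : segment ℝ x (x + t • (x - a)) ∩ (Z ∪ segment ℝ a x) ⊆ {x} := by
    rintro y ⟨hy, hyZ | hya⟩
    · exact absurd hyZ (hball ((convex_ball x r).segment_subset (Metric.mem_ball_self hr) hxt hy))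
    · exact segment_inter_segment_subset hmem ⟨hya, hy⟩
  exact ⟨_, fun he => hxe (hinter ⟨right_mem_segment ℝ _ _, he⟩).symm, hinter⟩

theorem exists_crossbar (hZ : IsClosed Z) (hpq : p ≠ q) (hm : m ∈ segment ℝ p q) (hmZ : m ∉ Z) :
    ∃ c d, c ≠ m ∧ d ≠ m ∧ m ∈ openSegment ℝ c d ∧
      segment ℝ c d ∩ (Z ∪ segment ℝ p q) ⊆ {m} := by
  obtain ⟨r, hr, hball⟩ := Metric.isOpen_iff.1 hZ.isOpen_compl m hmZ
  obtain ⟨v, hv⟩ := exists_side_linear_pos hpq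
  have hm0 := side_eq_zero_of_mem_segment hm
  have hplus := eventually_add_smul_mem (Metric.ball_mem_nhds m hr) v
  have hminus := eventually_add_smul_mem (Metric.ball_mem_nhds m hr) (-v)
  simp only [smul_neg, ← sub_eq_add_neg] at hminus
  obtain ⟨t, ⟨hplus, hminus⟩, ht⟩ :=
    ((hplus.and hminus).filter_mono nhdsWithin_le_nhds).and
      (self_mem_nhdsWithin (a := (0 : ℝ)) (s := Ioi 0)) |>.exists
  have htv : t • v ≠ 0 := smul_ne_zero (ne_of_gt ht) fun hv0 => hv.ne (by rw [hv0, map_zero])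
  refine ⟨m + t • v, m - t • v, fun h => htv (add_eq_left.1 h), fun h => htv (sub_eq_self.1 h), ?_,
    ?_⟩
  · simpa only [midpoint_add_sub] using midpoint_mem_openSegment (𝕜 := ℝ) (m + t • v) (m - t • v)
  rintro x ⟨hx, hxZ | hxs⟩
  · exact absurd hxZ (hball ((convex_ball m r).segment_subset hplus hminus hx))
  rw [segment_eq_image'] at hx
  obtain ⟨τ, -, hτ⟩ := hx
  have hxm : x = m + ((1 - 2 * τ) * t) • v := hτ.symm.trans (by module)
  have hx0 := side_eq_zero_of_mem_segment hxs
  rw [hxm, side_add_smul hm0, mul_eq_zero, or_iff_left hv.ne'] at hx0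
  rw [mem_singleton_iff, hxm, hx0, zero_smul, add_zero]

theorem isSimple_subdivide (hl : IsSimple (p :: q :: l)) (hm : m ∈ openSegment ℝ p q) :
    IsSimple (p :: m :: q :: l) := by
  obtain ⟨hpq, hd, hl⟩ := isSimple_cons_cons.1 hl
  have hms := openSegment_subset_segment ℝ p q hm
  have hmp : m ≠ p := fun h => hpq (left_mem_openSegment_iff.1 (h ▸ hm))
  have hmq : m ≠ q := fun h => hpq (right_mem_openSegment_iff.1 (h ▸ hm))
  refine isSimple_cons_cons.2 ⟨hmp.symm, ?_, isSimple_cons_cons.2 ⟨hmq, ?_, hl⟩⟩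
  · rintro x ⟨hx, hx' | hx'⟩
    · exact segment_inter_segment_subset hms ⟨hx, hx'⟩
    · have hxq : x = q :=
        hd ⟨(convex_segment p q).segment_subset (left_mem_segment ℝ p q) hms hx, hx'⟩
      exact segment_inter_segment_subset hms ⟨hx, hxq ▸ right_mem_segment ℝ m q⟩
  · exact fun x hx => hd ⟨(segment_subset_segment_diff_left hms hmp hx.1).1, hx.2⟩

theorem carrier_subdivide (hm : m ∈ segment ℝ p q) :
    carrier (p :: m :: q :: l) = carrier (p :: q :: l) := by
  rw [carrier_cons_cons, carrier_cons_cons, carrier_cons_cons, ← union_assoc,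
    segment_union_segment hm]

end Plane

namespace Drawing

variable {D : Drawing} {V : List Plane} {E : List (List Plane)} {T T' : List Tip} {s t : Tip}
  {z w : Plane}

/-- The points of the vertices, edges and open arms of a drawing. -/
def picture (D : Drawing) : Set Plane := D.graph ∪ carriers (D.tips.map Tip.stub)

theorem isClosed_picture (D : Drawing) : IsClosed D.picture :=
  D.isClosed_graph.union (isCompact_carriers _).isClosed

theorem picture_cons_tip :
    (mk V E (s :: T)).picture = (mk V E T).picture ∪ segment ℝ s.root s.free := by
  rw [picture, picture, List.map_cons, carriers_cons, carrier_stub, union_assoc,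
    union_comm (carriers _)]
  rfl

theorem picture_of_perm (h : T.Perm T') : (mk V E T).picture = (mk V E T').picture := by
  have hT : ∀ x, x ∈ carriers (T.map Tip.stub) ↔ x ∈ carriers (T'.map Tip.stub) := fun x => by
    simp only [carriers, mem_ofPred_eq, (h.map Tip.stub).mem_iff]
  ext x
  exact or_congr_right (hT x)

theorem isPlane_of_perm (h : T.Perm T') (hD : (mk V E T).IsPlane) : (mk V E T').IsPlane :=
  have hc : (mk V E T).curves.Perm (mk V E T').curves := (h.map _).append_left _
  ⟨hD.nodup, fun A hA => hD.isArc A (hc.mem_iff.2 hA), hD.edge_ends,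
    fun s hs => hD.tip_ends s (h.mem_iff.2 hs), noncrossing_of_perm hc hD.noncrossing⟩

theorem mem_picture_of_mem_curves {A : List Plane} (hA : A ∈ D.curves) (hx : x ∈ carrier A) :
    x ∈ D.picture :=
  (List.mem_append.1 hA).imp (fun hA => .inr ⟨A, hA, hx⟩) fun hA => ⟨A, hA, hx⟩

theorem isPlane_cons_tip : (mk V E (s :: T)).IsPlane ↔ (mk V E T).IsPlane ∧ s.root ∈ V ∧
    s.root ≠ s.free ∧ segment ℝ s.root s.free ∩ (mk V E T).picture ⊆ {s.root} := by
  have hc : (mk V E (s :: T)).curves.Perm (s.stub :: (mk V E T).curves) := List.perm_middle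
  constructor
  · intro hD
    have hs : s ∈ s :: T := List.mem_cons_self
    have hnon := List.pairwise_cons.1 (noncrossing_of_perm hc hD.noncrossing)
    refine ⟨⟨hD.nodup, fun A hA => hD.isArc A (hc.mem_iff.2 (List.mem_cons_of_mem _ hA)),
      hD.edge_ends, fun u hu => hD.tip_ends u (List.mem_cons_of_mem _ hu), hnon.2⟩,
      hD.root_mem hs, hD.root_ne_free hs, ?_⟩
    rintro x ⟨hx, hxG | ⟨A, hA, hxA⟩⟩
    · exact hD.eq_root_of_mem_graph hs hx hxG
    · have hxV := hnon.1 A (List.mem_append_right _ hA) x ⟨carrier_stub s ▸ hx, hxA⟩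
      exact hD.eq_root_of_mem_vertices hs hxV hx
  · rintro ⟨hD, hsV, hne, hd⟩
    refine ⟨hD.nodup, fun A hA => ?_, hD.edge_ends, List.forall_mem_cons.2 ⟨⟨hsV, fun v hv hvs =>
      hd ⟨carrier_stub s ▸ hvs, .inl (.inl hv)⟩⟩, hD.tip_ends⟩, noncrossing_of_perm hc.symm <|
      List.pairwise_cons.2 ⟨fun A hA x hx => ?_, hD.noncrossing⟩⟩
    · rcases List.mem_cons.1 (hc.mem_iff.1 hA) with rfl | hA
      exacts [⟨le_rfl, isSimple_pair.2 hne⟩, hD.isArc A hA]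
    · have hxs : x = s.root := hd ⟨carrier_stub s ▸ hx.1, mem_picture_of_mem_curves hA hx.2⟩
      exact hxs ▸ hsV

theorem picture_cons_vertex : (mk (x :: V) E T).picture = insert x (mk V E T).picture := by
  ext y
  simp only [picture, graph, mem_union, mem_ofPred_eq, List.mem_cons, mem_insert_iff, or_assoc]

theorem picture_cons_edge {A : List Plane} :
    (mk V (A :: E) T).picture = carrier A ∪ (mk V E T).picture := by
  ext y
  simp only [picture, graph, carriers_cons, mem_union, or_assoc, or_left_comm]

theorem isPlane_cons_vertex (hD : (mk V E T).IsPlane) (hx : x ∉ (mk V E T).picture) :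
    (mk (x :: V) E T).IsPlane where
  nodup := List.nodup_cons.2 ⟨fun h => hx (.inl (.inl h)), hD.nodup⟩
  isArc := hD.isArc
  edge_ends A hA := by
    obtain ⟨u, hu, w, hw, hAu, hAw, h⟩ := hD.edge_ends A hA
    refine ⟨u, List.mem_cons_of_mem _ hu, w, List.mem_cons_of_mem _ hw, hAu, hAw,
      List.forall_mem_cons.2 ⟨fun hxA => absurd ?_ hx, h⟩⟩
    exact mem_picture_of_mem_curves (List.mem_append_left _ hA) hxA
  tip_ends s hs := by
    obtain ⟨hsV, h⟩ := hD.tip_ends s hs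
    refine ⟨List.mem_cons_of_mem _ hsV, List.forall_mem_cons.2 ⟨fun hxs => absurd ?_ hx, h⟩⟩
    exact mem_picture_of_mem_curves (List.mem_append_right _ (List.mem_map_of_mem hs)) hxs
  noncrossing := hD.noncrossing.imp fun h y hy => List.mem_cons_of_mem _ (h y hy)

theorem isPlane_cons_edge {A : List Plane} {u w : Plane} (hD : (mk V E T).IsPlane) (hA : IsArc A)
    (hu : u ∈ V) (hw : w ∈ V) (hAu : A.head? = some u) (hAw : A.getLast? = some w)
    (hd : carrier A ∩ (mk V E T).picture ⊆ {u, w}) : (mk V (A :: E) T).IsPlane where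
  nodup := hD.nodup
  isArc := List.forall_mem_cons.2 ⟨hA, hD.isArc⟩
  edge_ends := List.forall_mem_cons.2
    ⟨⟨u, hu, w, hw, hAu, hAw, fun v hv hvA => hd ⟨hvA, .inl (.inl hv)⟩⟩, hD.edge_ends⟩
  tip_ends := hD.tip_ends
  noncrossing := List.pairwise_cons.2 ⟨fun B hB x hx => by
    rcases hd ⟨hx.1, mem_picture_of_mem_curves hB hx.2⟩ with rfl | rfl
    exacts [hu, hw], hD.noncrossing⟩

theorem polyJoined_compl_picture (hD : (mk V E T).IsPlane) (hz : z ∉ (mk V E T).picture)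
    (hw : w ∉ (mk V E T).picture) (h : PolyJoined (mk V E T).graphᶜ z w) :
    PolyJoined (mk V E T).pictureᶜ z w := by
  induction T with
  | nil => simpa only [picture, List.map_nil, carriers_nil, union_empty] using h
  | cons s T ih =>
    obtain ⟨hD, -, hne, hd⟩ := isPlane_cons_tip.1 hD
    rw [picture_cons_tip, segment_symm] at hz hw ⊢
    rw [segment_symm] at hd
    exact (ih hD (hz ∘ .inl) (hw ∘ .inl) h).union_segment_of_free (isClosed_picture _) hne.symm hd
      (fun hs => hne (hd ⟨left_mem_segment ℝ _ _, hs⟩).symm) hz hw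

namespace IsPlane

theorem exists_prolongation (hD : D.IsPlane) (hs : s ∈ D.tips) :
    ∃ e ∉ D.picture, segment ℝ s.free e ∩ D.picture ⊆ {s.free} := by
  classical
  have hT := List.perm_cons_erase hs
  obtain ⟨-, -, hne, hd⟩ := isPlane_cons_tip.1 (isPlane_of_perm hT hD)
  have hpic : D.picture = _ := (picture_of_perm hT).trans picture_cons_tip
  rw [hpic]
  exact exists_prolongation_segment (isClosed_picture _)
    (fun hs => hne (hd ⟨right_mem_segment ℝ _ _, hs⟩).symm) hne

theorem exists_curve (hD : D.IsPlane) (hs : s ∈ D.tips) (ht : t ∈ D.tips)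
    (hst : PolyJoined D.graphᶜ s.free t.free) : ∃ l, IsSimple (s.free :: l) ∧
      (s.free :: l).getLast? = some t.free ∧
      carrier (s.free :: l) ∩ D.picture ⊆ {s.free, t.free} := by
  have near : ∀ {u e}, segment ℝ u e ∩ D.picture ⊆ {u} → u ∉ D.graph →
      PolyJoined D.graphᶜ u e := fun hue hu =>
    .of_segment fun x hx hxG => hu ((hue ⟨hx, .inl hxG⟩ : x = _) ▸ hxG)
  obtain ⟨e, he, hse⟩ := hD.exists_prolongation hs
  obtain ⟨f, hf, htf⟩ := hD.exists_prolongation ht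
  have hef : PolyJoined D.graphᶜ e f :=
    ((near hse (hD.free_notMem_graph hs)).symm.trans hst).trans (near htf (hD.free_notMem_graph ht))
  have hmain : PolyJoined (D.pictureᶜ ∪ {s.free, t.free}) s.free t.free := by
    have h := (polyJoined_compl_picture hD he hf hef).mono
      (subset_union_left (t := {s.free, t.free}))
    refine .trans (.of_segment fun x hx => ?_) (h.trans (.symm (.of_segment fun x hx => ?_)))
    · exact or_iff_not_imp_left.2 fun hxp => .inl (hse ⟨hx, not_not.1 hxp⟩)
    · exact or_iff_not_imp_left.2 fun hxp => .inr (htf ⟨hx, not_not.1 hxp⟩)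
  obtain ⟨l, hl, hlast, hls⟩ := hmain.exists_isSimple (.inr (.inr rfl))
  exact ⟨l, hl, hlast, fun x hx => (hls hx.1).resolve_left (not_not.2 hx.2)⟩

end IsPlane

end Drawing

namespace Drawing

variable {V : List Plane} {E : List (List Plane)} {T : List Tip} {s t : Tip} {m p q x : Plane}
  {l : List Plane}

theorem carrier_append_root :
    carrier (m :: (l ++ [s.free, s.root])) =
      carrier (m :: (l ++ [s.free])) ∪ segment ℝ s.root s.free := by
  rw [← List.cons_append, carrier_append, List.cons_append, carrier_pair, segment_symm]

theorem isPlane_cons_edge_of_tip (hD : (mk V E (s :: T)).IsPlane) (hm : m ∈ V)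
    (hms : m ∉ segment ℝ s.root s.free) (hl : IsSimple (m :: (l ++ [s.free])))
    (hd : carrier (m :: (l ++ [s.free])) ∩ (mk V E (s :: T)).picture ⊆ {m, s.free}) :
    (mk V ((m :: (l ++ [s.free, s.root])) :: E) T).IsPlane ∧
      (mk V ((m :: (l ++ [s.free, s.root])).reverse :: E) T).IsPlane := by
  obtain ⟨hD, hsV, hne, hsd⟩ := isPlane_cons_tip.1 hD
  have hfree : s.free ∉ (mk V E T).picture := fun h =>
    hne (hsd ⟨right_mem_segment ℝ _ _, h⟩).symm
  rw [picture_cons_tip] at hd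
  set A := m :: (l ++ [s.free, s.root])
  have hA : IsArc A := by
    refine ⟨by simp [A], (isSimple_append (l₁ := m :: l)).2 ⟨hl, isSimple_pair.2 hne.symm, ?_⟩⟩
    rw [carrier_pair, segment_symm]
    rintro x ⟨hx, hxs⟩
    exact (hd ⟨hx, .inr hxs⟩).resolve_left fun hxm => hms (hxm ▸ hxs)
  have hAd : carrier A ∩ (mk V E T).picture ⊆ {m, s.root} := by
    rw [carrier_append_root]
    rintro x ⟨hx | hx, hxP⟩
    · exact .inl ((hd ⟨hx, .inl hxP⟩).resolve_right fun hxs => hfree (hxs ▸ hxP))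
    · exact .inr (hsd ⟨hx, hxP⟩)
  have hlast : A.getLast? = some s.root := by
    rw [show A = m :: (l ++ [s.free]) ++ [s.root] by simp [A], List.getLast?_concat]
  refine ⟨isPlane_cons_edge hD hA hm hsV rfl hlast hAd, isPlane_cons_edge hD
    ⟨by simpa only [List.length_reverse] using hA.1, hA.2.reverse⟩ hsV hm
    (List.head?_reverse.trans hlast) (List.getLast?_reverse.trans rfl) ?_⟩
  rwa [carrier_reverse, pair_comm]

theorem isPlane_join_tips (hD : (mk V E (s :: t :: T)).IsPlane)
    (hm : m ∉ (mk V E (s :: t :: T)).picture) (hl : IsSimple (s.free :: m :: (l ++ [t.free])))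
    (hd : carrier (s.free :: m :: (l ++ [t.free])) ∩ (mk V E (s :: t :: T)).picture ⊆
      {s.free, t.free}) :
    (mk (m :: V) ([s.root, s.free, m] :: (m :: (l ++ [t.free, t.root])) :: E) T).IsPlane := by
  obtain ⟨hsm, hLR, hR⟩ := isSimple_cons_cons.1 hl
  have hswap : (s :: t :: T).Perm (t :: s :: T) := .swap _ _ _
  have hpic : (mk V E (s :: t :: T)).picture =
    (mk V E (s :: T)).picture ∪ segment ℝ t.root t.free :=
    (picture_of_perm hswap).trans picture_cons_tip
  have hright : (mk (m :: V) ((m :: (l ++ [t.free, t.root])) :: E) (s :: T)).IsPlane := by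
    refine (isPlane_cons_edge_of_tip (isPlane_of_perm hswap (isPlane_cons_vertex hD hm))
      List.mem_cons_self (fun h => hm (hpic ▸ .inr h)) hR ?_).1
    rw [picture_cons_vertex, picture_of_perm hswap.symm]
    rintro x ⟨hx, rfl | hxP⟩
    · exact .inl rfl
    · exact .inr ((hd ⟨.inr hx, hxP⟩).resolve_left fun h => hl.notMem_carrier_tail (h ▸ hx))
  have htfree : t.free ∈ carrier (m :: (l ++ [t.free])) :=
    mem_carrier_of_getLast? (List.getLast?_concat (l := m :: l))
  refine (isPlane_cons_edge_of_tip (l := []) hright List.mem_cons_self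
    (fun h => hm (picture_cons_tip ▸ .inr h)) (isSimple_pair.2 hsm.symm) ?_).2
  rw [picture_cons_edge, picture_cons_vertex, List.nil_append, carrier_pair, segment_symm,
    carrier_append_root]
  have hleft : segment ℝ s.free m ∩ (mk V E (s :: t :: T)).picture ⊆ {s.free} := fun x hx =>
    (hd ⟨.inl hx.1, hx.2⟩).resolve_right fun hxt => hm <|
      (hLR ⟨hx.1, hxt ▸ htfree⟩ : x = m) ▸ hx.2
  rintro x ⟨hx, (hxR | hxt) | rfl | hxP⟩
  · exact .inl (hLR ⟨hx, hxR⟩)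
  · exact .inr (hleft ⟨hx, hpic ▸ .inr hxt⟩)
  · exact .inl rfl
  · exact .inr (hleft ⟨hx, hpic ▸ .inl hxP⟩)

theorem picture_join_tips_subset :
    (mk (m :: V) ([s.root, s.free, m] :: (m :: (l ++ [t.free, t.root])) :: E) T).picture ⊆
      (mk V E (s :: t :: T)).picture ∪ carrier (s.free :: m :: (l ++ [t.free])) := by
  rw [picture_cons_edge, picture_cons_edge, picture_cons_vertex, picture_cons_tip, picture_cons_tip,
    carrier_append_root, carrier_cons_cons, carrier_pair, carrier_cons_cons]
  have hm := head_mem_carrier m (l ++ [t.free])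
  rintro x ((hx | hx) | (hx | hx) | rfl | hx)
  exacts [.inl (.inr hx), .inr (.inl hx), .inr (.inr hx), .inl (.inl (.inr hx)), .inr (.inr hm),
    .inl (.inl (.inl hx))]

theorem isPlane_cons_crossbar {c d : Plane} (hD : (mk V E T).IsPlane) (hm : m ∈ V) (hc : c ≠ m)
    (hd : d ≠ m) (hmcd : m ∈ segment ℝ c d)
    (hcd : segment ℝ c d ∩ (mk V E T).picture ⊆ {m}) :
    (mk V E (⟨m, c⟩ :: ⟨m, d⟩ :: T)).IsPlane := by
  rw [← segment_union_segment hmcd, segment_symm ℝ c m] at hcd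
  refine isPlane_cons_tip.2 ⟨isPlane_cons_tip.2 ⟨hD, hm, hd.symm, fun x hx =>
    hcd ⟨.inr hx.1, hx.2⟩⟩, hm, hc.symm, ?_⟩
  rw [picture_cons_tip]
  rintro x ⟨hx, hxP | hxd⟩
  · exact hcd ⟨.inl hx, hxP⟩
  · exact segment_inter_segment_subset hmcd ⟨segment_symm ℝ m c ▸ hx, hxd⟩

theorem exists_isMove_of_curve (hD : (mk V E (s :: t :: T)).IsPlane)
    (hl : IsSimple (s.free :: q :: l)) (hlast : (q :: l).getLast? = some t.free)
    (hd : carrier (s.free :: q :: l) ∩ (mk V E (s :: t :: T)).picture ⊆ {s.free, t.free}) :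
    ∃ D', IsMove (mk V E (s :: t :: T)) D' := by
  set m := midpoint ℝ s.free q
  have hm : m ∈ openSegment ℝ s.free q := midpoint_mem_openSegment _ _
  have hms := openSegment_subset_segment ℝ _ _ hm
  have hml := isSimple_subdivide hl hm
  obtain ⟨hsm, -, hmql⟩ := isSimple_cons_cons.1 hml
  have hmq : m ∉ carrier (q :: l) := hmql.notMem_carrier_tail
  have hmP : m ∉ (mk V E (s :: t :: T)).picture := fun h => by
    rcases hd ⟨.inl hms, h⟩ with h | h
    exacts [hsm h.symm, hmq (h ▸ mem_carrier_of_getLast? hlast)]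
  obtain ⟨c, d, hc, hd', hmcd, hcd⟩ := exists_crossbar
    ((isClosed_picture _).union (isCompact_carrier (q :: l)).isClosed) (isSimple_cons_cons.1 hl).1
    hms (not_or.2 ⟨hmP, hmq⟩)
  obtain ⟨l', hl'⟩ := List.getLast?_eq_some_iff.1 hlast
  rw [← carrier_subdivide hms, hl'] at hd
  have hjoin := isPlane_join_tips hD hmP (hl' ▸ hml) hd
  have hcross : segment ℝ c d ∩ (mk (m :: V)
      ([s.root, s.free, m] :: (m :: (l' ++ [t.free, t.root])) :: E) T).picture ⊆ {m} := by
    refine (inter_subset_inter_right _ (picture_join_tips_subset.trans ?_)).trans hcd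
    rw [← hl', carrier_subdivide hms, carrier_cons_cons, union_assoc, union_comm (carrier _)]
  refine ⟨_, s, t, T, [], l, s.free, q, m, c, d, .rfl, rfl, hlast, hm, hmcd, rfl, ?_, rfl,
    isPlane_cons_crossbar hjoin List.mem_cons_self hc hd' (openSegment_subset_segment ℝ _ _ hmcd)
      hcross⟩
  have hedge : l' ++ [t.free, t.root] = q :: (l ++ [t.root]) := by
    rw [← List.cons_append, hl', List.append_assoc, List.singleton_append]
  rw [hedge, List.nil_append]

theorem IsPlane.exists_isMove {D : Drawing} (hD : D.IsPlane) (hs : s ∈ D.tips) (ht : t ∈ D.tips)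
    (hst : s ≠ t) (hj : PolyJoined D.graphᶜ s.free t.free) : ∃ D', IsMove D D' := by
  obtain ⟨T, hT⟩ : ∃ T, D.tips.Perm (s :: t :: T) := by
    classical
    have ht' := (List.mem_erase_of_ne hst.symm).2 ht
    exact ⟨_, (List.perm_cons_erase hs).trans ((List.perm_cons_erase ht').cons s)⟩
  have hD' := isPlane_of_perm hT hD
  have hfree : s.free ≠ t.free := fun h => by
    obtain ⟨-, -, hne, hd⟩ := isPlane_cons_tip.1 hD'
    refine hne (hd ⟨right_mem_segment ℝ _ _, ?_⟩).symm
    exact picture_cons_tip ▸ .inr (h ▸ right_mem_segment ℝ _ _)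
  obtain ⟨_ | ⟨q, l⟩, hl, hlast, hd⟩ := hD.exists_curve hs ht hj
  · exact absurd (Option.some.inj hlast) hfree
  · obtain ⟨D', s', t', T', l₁, l₂, p', q', m, c, d, hT', hmove⟩ :=
      exists_isMove_of_curve hD' hl hlast (picture_of_perm hT ▸ hd)
    exact ⟨D', s', t', T', l₁, l₂, p', q', m, c, d, hT.trans hT', hmove⟩

end Drawing

theorem isPreconnected_ball_diff_center {E : Type*} [NormedAddCommGroup E] [NormedSpace ℝ E]
    (h : 1 < Module.rank ℝ E) (c : E) (r : ℝ) : IsPreconnected (Metric.ball c r \ {c}) := by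
  rcases le_or_gt r 0 with hr | hr
  · rw [Metric.ball_eq_empty.2 hr, empty_sdiff]
    exact isPreconnected_empty
  have himage : OpenPartialHomeomorph.univBall c r '' {0}ᶜ = Metric.ball c r \ {c} := by
    have hinj := (OpenPartialHomeomorph.univBall c r).injOn
    have htarget := (OpenPartialHomeomorph.univBall c r).image_source_eq_target
    rw [OpenPartialHomeomorph.univBall_source] at hinj htarget
    rw [OpenPartialHomeomorph.univBall_target c hr] at htarget
    rw [compl_eq_univ_sdiff, image_sdiff (injOn_univ.1 hinj), htarget, image_singleton,
      OpenPartialHomeomorph.univBall_apply_zero]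
  rw [← himage]
  exact (isConnected_compl_singleton_of_one_lt_rank h 0).isPreconnected.image _
    (OpenPartialHomeomorph.continuous_univBall c r).continuousOn

theorem exists_mem_segment_ne_left {E : Type*} [AddCommGroup E] [Module ℝ E] [TopologicalSpace E]
    [ContinuousAdd E] [ContinuousSMul ℝ E] {x w : E} {U : Set E} (hU : U ∈ 𝓝 x) (hw : w ≠ x) :
    ∃ y ∈ segment ℝ x w, y ∈ U ∧ y ≠ x := by
  obtain ⟨t, htU, ht0, ht1⟩ := (((eventually_add_smul_mem hU (w - x)).filter_mono
    nhdsWithin_le_nhds).and (Ioo_mem_nhdsGT one_pos)).exists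
  refine ⟨_, segment_eq_image' ℝ x w ▸ mem_image_of_mem _ ⟨ht0.le, ht1.le⟩, htU, ?_⟩
  rw [ne_eq, add_eq_left, smul_eq_zero, sub_eq_zero]
  exact not_or.2 ⟨ht0.ne', hw⟩

namespace Drawing

theorem Linked.eq_of_edges_eq_nil {D : Drawing} {u w : Plane} (h : D.Linked u w)
    (hD : D.edges = []) : u = w := by
  induction h with
  | rel u w h =>
    obtain ⟨A, hA, -⟩ := h
    exact absurd (hD ▸ hA) List.not_mem_nil
  | refl => rfl
  | symm _ _ _ ih => exact ih.symm
  | trans _ _ _ _ _ ih ih' => exact ih.trans ih'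

namespace IsInitial

variable {n : ℕ} {t : Fin n → ℕ} {D : Drawing}

theorem isPlane (hD : D.IsInitial t) : D.IsPlane := by
  obtain ⟨v, a, -, -, -, h⟩ := hD
  exact h

theorem length_vertices (hD : D.IsInitial t) : D.vertices.length = n := by
  obtain ⟨v, a, h, -⟩ := hD
  rw [h, List.length_ofFn]

theorem edges_eq_nil (hD : D.IsInitial t) : D.edges = [] := by
  obtain ⟨v, a, -, h, -⟩ := hD
  exact h

theorem length_tips (hD : D.IsInitial t) : D.tips.length = ∑ i, t i := by
  obtain ⟨v, a, -, -, h, -⟩ := hD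
  simp only [h, List.length_flatten, List.map_ofFn, List.sum_ofFn, Function.comp_apply,
    List.length_ofFn]

theorem exists_tip (hD : D.IsInitial t) (ht : ∀ i, 1 ≤ t i) {v : Plane} (hv : v ∈ D.vertices) :
    ∃ s ∈ D.tips, s.root = v := by
  obtain ⟨w, a, hV, -, hT, -⟩ := hD
  obtain ⟨i, rfl⟩ := List.mem_ofFn.1 (hV ▸ hv)
  refine ⟨⟨w i, a i ⟨0, ht i⟩⟩, ?_, rfl⟩
  rw [hT, List.mem_flatten]
  exact ⟨_, List.mem_ofFn.2 ⟨i, rfl⟩, List.mem_ofFn.2 ⟨_, rfl⟩⟩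

theorem graph_eq (hD : D.IsInitial t) : D.graph = {x | x ∈ D.vertices} := by
  rw [graph, hD.edges_eq_nil, carriers_nil, union_empty]

theorem component_subset (hD : D.IsInitial t) (v : Plane) : D.component v ⊆ {v} := by
  rintro x (⟨-, hvx⟩ | ⟨A, hA, -⟩)
  · exact (hvx.eq_of_edges_eq_nil hD.edges_eq_nil).symm
  · exact absurd (hD.edges_eq_nil ▸ hA) List.not_mem_nil

theorem tipsReachable (hD : D.IsInitial t) (ht : ∀ i, 1 ≤ t i) : D.TipsReachable := by
  intro v hv O hO hvO x hx z hz hxz hxzG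
  obtain rfl : x = v := hD.component_subset v hx
  obtain ⟨s, hs, rfl⟩ := hD.exists_tip ht hv
  have hclosed : IsClosed ({y | y ∈ D.vertices} \ {s.root}) :=
    (D.vertices.finite_toSet.sdiff).isClosed
  obtain ⟨r, hr, hball⟩ := Metric.isOpen_iff.1 (hO.inter hclosed.isOpen_compl) s.root
    ⟨hxz (left_mem_segment ℝ _ _), fun h => h.2 rfl⟩
  have hzs : z ≠ s.root := fun h => hz (h ▸ hD.graph_eq ▸ hv)
  obtain ⟨z', hz's, hz'b, hz'⟩ := exists_mem_segment_ne_left (Metric.ball_mem_nhds s.root hr) hzs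
  obtain ⟨y, hys, hyb, hy⟩ := exists_mem_segment_ne_left (Metric.ball_mem_nhds s.root hr)
    (hD.isPlane.root_ne_free hs).symm
  have hzz' : PolyJoined (O \ D.graph) z z' := .symm <| .of_segment fun a ha =>
    have ha := segment_subset_segment_diff_left hz's hz' ha
    ⟨hxz ha.1, fun haG => ha.2 (hxzG ⟨ha.1, haG⟩)⟩
  have hz'y : PolyJoined (Metric.ball s.root r \ {s.root}) z' y :=
    .of_isPreconnected (isPreconnected_ball_diff_center (by simp [one_add_one_eq_two]) _ _)
      (Metric.isOpen_ball.sdiff isClosed_singleton) ⟨hz'b, hz'⟩ ⟨hyb, hy⟩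
  refine ⟨s, hs, .refl _, y, hys, hy, hzz'.trans (hz'y.mono fun a ha => ⟨(hball ha.1).1, ?_⟩)⟩
  rw [hD.graph_eq]
  exact fun haV => (hball ha.1).2 ⟨haV, ha.2⟩

end IsInitial

/-- What is known about a position reached after `k` moves from `n` spots with `T` tips. The last
field holds at the start because there is at least one tip, and every move increases
`numFaces - numComponents`. -/
structure Reached (n T k : ℕ) (D : Drawing) : Prop where
  isPlane : D.IsPlane
  length_vertices : D.vertices.length = n + k
  length_edges : D.edges.length = 2 * k
  length_tips : D.tips.length = T
  tipsReachable : D.TipsReachable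
  count : 1 + D.numComponents + k ≤ D.numFaces + n

theorem IsInitial.reached {n : ℕ} {t : Fin n → ℕ} {D : Drawing} (hD : D.IsInitial t)
    (hn : 1 ≤ n) (ht : ∀ i, 1 ≤ t i) : D.Reached n (∑ i, t i) 0 where
  isPlane := hD.isPlane
  length_vertices := hD.length_vertices
  length_edges := by rw [hD.edges_eq_nil]; rfl
  length_tips := hD.length_tips
  tipsReachable := hD.tipsReachable ht
  count := by
    have hcomp := D.numComponents_le
    rw [hD.length_vertices] at hcomp
    obtain ⟨v, hv⟩ := List.exists_mem_of_length_pos (hn.trans_eq hD.length_vertices.symm)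
    obtain ⟨s, hs, -⟩ := hD.exists_tip ht hv
    have hfaces := numFaces_pos (List.ne_nil_of_mem hs)
    omega

end Drawing

theorem IsMove.reached {n T k : ℕ} {D D' : Drawing} (h : IsMove D D') (hD : D.Reached n T k) :
    D'.Reached n T (k + 1) := by
  obtain ⟨s, t, rest, l₁, l₂, p, q, m, c, d, h⟩ := h.exists_moveData
  refine ⟨h.isPlane, ?_, ?_, ?_, h.tipsReachable hD.isPlane hD.tipsReachable, ?_⟩
  · rw [h.vertices, List.length_cons, hD.length_vertices, add_assoc]
  · rw [h.edges, List.length_cons, List.length_cons, hD.length_edges]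
    ring
  · rw [h.tips, ← hD.length_tips, h.perm.length_eq]
    rfl
  · have := hD.count
    have := h.numFaces_add_numComponents_lt hD.isPlane
    omega

theorem IsPlay.reached {n T k : ℕ} {D D' : Drawing} (h : IsPlay D k D') (hD : D.Reached n T 0) :
    D'.Reached n T k := by
  induction h with
  | start => exact hD
  | step _ hmove ih => exact hmove.reached ih

namespace Drawing.Reached

variable {n T k : ℕ} {D : Drawing}

theorem vertices_ne_nil (hD : D.Reached n T k) (hn : 1 ≤ n) : D.vertices ≠ [] := by
  rw [← List.length_pos_iff, hD.length_vertices]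
  omega

theorem le (hD : D.Reached n T k) (hn : 1 ≤ n) : k + 2 ≤ n + T := by
  have hcount := hD.count
  have hfaces := D.numFaces_le
  rw [hD.length_tips] at hfaces
  have hcomp := numComponents_pos (hD.vertices_ne_nil hn)
  omega

theorem exists_isMove (hD : D.Reached n T k) (hn : 1 ≤ n) (hk : k + 2 < n + T) :
    ∃ D', IsMove D D' := by
  by_contra! hover
  have hsep : D.TipsSeparated := by
    intro s hs t ht hst
    by_contra hne
    obtain ⟨D', hD'⟩ := hD.isPlane.exists_isMove hs ht hne hst
    exact hover D' hD'
  have hconn := hsep.isConnected hD.isPlane hD.tipsReachable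
  obtain ⟨N, hN, heuler⟩ := hD.isPlane.hasFacesLE_of_isConnected (hD.vertices_ne_nil hn) hconn
  have htips := hsep.length_tips_le hD.isPlane hN
  rw [hD.length_tips] at htips
  rw [hD.length_vertices, hD.length_edges] at heuler
  omega

theorem isOver_iff (hD : D.Reached n T k) (hn : 1 ≤ n) : IsOver D ↔ k + 2 = n + T := by
  refine ⟨fun hover => ?_, fun hk D' hmove => ?_⟩
  · by_contra hne
    obtain ⟨D', hmove⟩ := hD.exists_isMove hn (lt_of_le_of_ne (hD.le hn) hne)
    exact hover D' hmove
  · have := (hmove.reached hD).le hn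
    omega

theorem canForceWin (hn : 1 ≤ n) {j : ℕ} (hD : D.Reached n T k) (hk : k + 2 * j + 3 = n + T) :
    CanForceWin D := by
  induction j generalizing k D with
  | zero =>
    obtain ⟨D', hmove⟩ := hD.exists_isMove hn (by omega)
    have hover := ((hmove.reached hD).isOver_iff hn).2 (by omega)
    exact .intro D D' hmove fun D'' hmove' => absurd hmove' (hover D'')
  | succ j ih =>
    obtain ⟨D', hmove⟩ := hD.exists_isMove hn (by omega)
    exact .intro D D' hmove fun D'' hmove' => ih (hmove'.reached (hmove.reached hD)) (by omega)

theorem odd_of_canForceWin (hn : 1 ≤ n) (hD : D.Reached n T k) (h : CanForceWin D) :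
    Odd (n + T + k) := by
  induction h generalizing k with
  | intro D D' hmove _ ih =>
    have hD' := hmove.reached hD
    rcases (hD'.le hn).eq_or_lt with hk | hk
    · exact ⟨k + 1, by omega⟩
    · obtain ⟨D'', hmove'⟩ := hD'.exists_isMove hn hk
      have hodd := ih D'' hmove' (hmove'.reached hD')
      rw [add_assoc k, ← add_assoc, Nat.odd_add] at hodd
      exact hodd.2 even_two

theorem canForceWin_iff (hn : 1 ≤ n) (hD : D.Reached n T k) :
    CanForceWin D ↔ Odd (n + T + k) := by
  refine ⟨hD.odd_of_canForceWin hn, fun ⟨j, hj⟩ => ?_⟩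
  have := hD.le hn
  exact hD.canForceWin hn (j := j - k - 1) (by omega)

end Drawing.Reached

theorem turn_eq_second_iff (k : ℕ) : turn k = .second ↔ Odd k := by
  induction k with
  | zero => simp [turn]
  | succ k ih =>
    rw [Nat.odd_add_one, ← ih, turn]
    cases turn k <;> simp [Player.other]

theorem winnerAfter_eq_first_iff (k : ℕ) : winnerAfter k = .first ↔ Odd k := by
  rw [← turn_eq_second_iff, winnerAfter]
  cases turn k <;> simp [Player.other]

end BrusselsSprout

theorem corollary1 (n : ℕ) (hn : 1 ≤ n) (t : Fin n → ℕ) (ht : ∀ i, 1 ≤ t i)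
    (D : BrusselsSprout.Drawing) (hD : D.IsInitial t) :
    (∃ N : ℕ, (N : ℤ) = ((n : ℤ) - 2) + ∑ i, (t i : ℤ) ∧
      BrusselsSprout.EndsAfterExactly D N) ∧
    (∀ (k : ℕ) (D' : BrusselsSprout.Drawing),
      BrusselsSprout.IsPlay D k D' → BrusselsSprout.IsOver D' →
        (BrusselsSprout.winnerAfter k = BrusselsSprout.Player.first ↔ Odd (n + ∑ i, t i))) ∧
    (BrusselsSprout.CanForceWin D ↔ Odd (n + ∑ i, t i)) := by
  have hstart := hD.reached hn ht
  refine ⟨⟨n + ∑ i, t i - 2, ?_, fun k D' hplay => ?_⟩, fun k D' hplay hover => ?_,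
    hstart.canForceWin_iff hn⟩
  · have := hstart.le hn
    zify [show 2 ≤ n + ∑ i, t i by omega]
    ring
  · have hD' := hplay.reached hstart
    have := hD'.le hn
    rw [hD'.isOver_iff hn]
    omega
  · rw [BrusselsSprout.winnerAfter_eq_first_iff,
      ← ((hplay.reached hstart).isOver_iff hn).1 hover, Nat.odd_add, iff_true_right even_two]
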